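/- All manifolds and maps are $C^\infty$; manifolds are finite-dimensional, Hausdorff and without boundary. Let $G$ be a connected Lie group with Lie algebra $\mathfrak g=T_1G$, acting smoothly from the left on a manifold $Q$ by $\Phi:G\times Q\to Q$, $\Phi_g(q)=gq$. For $\xi\in\mathfrak g$ let $\xi_Q$ be the infinitesimal generator, $\xi_Q(q)=T_1(g\mapsto gq)(\xi)$. Let $\Phi^{T^*}$ be the cotangent lifted action of $G$ on $T^*Q$, $\Phi^{T^*}_g(\alpha_q)=\alpha_q\circ T_{gq}\Phi_{g^{-1}}\in T^*_{gq}Q$, and let $\xi_{T^*Q}(\alpha)=T_1(g\mapsto \Phi^{T^*}_g(\alpha))(\xi)$ be its infinitesimal generators. Let $\omega_Q=-d\theta_Q$ be the canonical symplectic form on $T^*Q$, where $\theta_Q$ is the tautological $1$-form $\theta_Q(\alpha)(v)=\alpha(T\pi(v))$, $\pi:T^*Q\to Q$, and let $J:T^*Q\to\mathfrak g^*$, $J(\alpha_q)(\xi)=\alpha_q(\xi_Q(q))$, be the momentum map. Let $L\subset T^*Q$ be a Lagrangian submanifold of $(T^*Q,\omega_Q)$, that is, an embedded submanifold such that for every $\alpha\in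 L$ the tangent space $T_\alpha L$ equals its own $\omega_Q$-orthogonal. Call $L$ $G$-invariant if $\Phi^{T^*}_g(L)=L$ for all $g\in G$. (1) If $L$ is connected and $G$-invariant, then $J$ is constant along $L$. (2) Suppose that $L$ is a closed subset of $T^*Q$ or, alternatively, that the restricted flows are globally defined, in the sense that for each $\xi\in\mathfrak g$ for which $\xi_{T^*Q}$ is tangent to $L$ at every point of $L$, the vector field $\xi_{T^*Q}|_L$ on $L$ is complete. If $J$ is constant along $L$, then $L$ is $G$-invariant. (3) In particular, if $L$ is connected and is closed in $T^*Q$ (or has globally defined restricted flows), then $J$ is constant along $L$ if and only if $L$ is $G$-invariant. -/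

import Mathlib

open scoped Manifold ContDiff

noncomputable section

section CotangentBundle

variable (E : Type*) [NormedAddCommGroup E] [NormedSpace ℝ E]
  (Q : Type*) [TopologicalSpace Q] [ChartedSpace E Q]

/-- The cotangent space `T_q^*Q`, the dual of the tangent space `T_qQ`. -/
abbrev CotangentSpace (q : Q) : Type _ :=
  TangentSpace 𝓘(ℝ, E) q →L[ℝ] Bundle.Trivial Q ℝ q

/-- The cotangent bundle `T^*Q`, with the topology and the smooth structure that Mathlib puts on
the bundle of continuous linear maps from the tangent bundle to the trivial line bundle. Its points
are pairs `⟨q, α⟩` with `α ∈ T_q^*Q`. -/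
abbrev CotangentBundle : Type _ :=
  Bundle.TotalSpace (E →L[ℝ] ℝ) (CotangentSpace E Q)

/-- The model with corners of the cotangent bundle; it has no boundary. -/
abbrev cotangentModel :
    ModelWithCorners ℝ (E × (E →L[ℝ] ℝ)) (ModelProd E (E →L[ℝ] ℝ)) :=
  𝓘(ℝ, E).prod 𝓘(ℝ, E →L[ℝ] ℝ)

end CotangentBundle

section ExteriorDerivative

variable {E : Type*} [NormedAddCommGroup E] [NormedSpace ℝ E]
  {H : Type*} [TopologicalSpace H] (I : ModelWithCorners ℝ E H)
  {M : Type*} [TopologicalSpace M] [ChartedSpace H M]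

/-- The local representative, in the chart of `M` around `x₀`, of a `1`-form `θ` on `M`: the
pullback of `θ` under the inverse of the chart, as a `1`-form on the model space. -/
def localOneForm (θ : (x : M) → (TangentSpace I x →L[ℝ] ℝ)) (x₀ : M) (y : E) : E →L[ℝ] ℝ :=
  (θ ((extChartAt I x₀).symm y)).comp (mfderiv 𝓘(ℝ, E) I (extChartAt I x₀).symm y)

/-- The exterior derivative `dθ` of a `1`-form `θ` on a manifold without boundary, at the point
`x` and on the tangent vectors `v, w`: take the exterior derivative of the local representative
of `θ` in the chart around `x`, and pull it back by the chart. -/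
def oneFormExtDeriv (θ : (x : M) → (TangentSpace I x →L[ℝ] ℝ)) (x : M)
    (v w : TangentSpace I x) : ℝ :=
  extDeriv (fun y : E ↦
      ContinuousAlternatingMap.ofSubsingleton ℝ E ℝ (0 : Fin 1) (localOneForm I θ x y))
    (extChartAt I x x)
    ![mfderiv I 𝓘(ℝ, E) (extChartAt I x) x v, mfderiv I 𝓘(ℝ, E) (extChartAt I x) x w]

end ExteriorDerivative

section Symplectic

variable {E : Type*} [NormedAddCommGroup E] [NormedSpace ℝ E]
  {Q : Type*} [TopologicalSpace Q] [ChartedSpace E Q] [IsManifold 𝓘(ℝ, E) ∞ Q]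

/-- The tautological (Liouville) `1`-form on `T^*Q`: `θ_α(v) = α(Tπ(v))`, where `π : T^*Q → Q` is
the projection. -/
def tautologicalForm (α : CotangentBundle E Q) :
    TangentSpace (cotangentModel E) α →L[ℝ] ℝ :=
  ContinuousLinearMap.comp (α.2 : TangentSpace 𝓘(ℝ, E) α.1 →L[ℝ] ℝ)
    (mfderiv (cotangentModel E) 𝓘(ℝ, E)
      (Bundle.TotalSpace.proj : CotangentBundle E Q → Q) α)

/-- The canonical symplectic form `ω_Q = -dθ` on `T^*Q` (locally `∑ dqⁱ ∧ dpᵢ`). -/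
def canonicalSymplecticForm (α : CotangentBundle E Q)
    (v w : TangentSpace (cotangentModel E) α) : ℝ :=
  - oneFormExtDeriv (cotangentModel E) tautologicalForm α v w

section Submanifold

variable (F : Type*) [NormedAddCommGroup F] [NormedSpace ℝ F]
  (L : Set (CotangentBundle E Q)) [ChartedSpace F L]

/-- The tangent space `T_αL ⊆ T_α(T^*Q)` of a submanifold `L` of `T^*Q` at a point `α ∈ L`: the
image of the tangent map of the inclusion. -/
def submanifoldTangentSpace (α : L) :
    Set (TangentSpace (cotangentModel E) (α : CotangentBundle E Q)) :=
  Set.range (mfderiv 𝓘(ℝ, F) (cotangentModel E) (Subtype.val : L → CotangentBundle E Q) α)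

/-- The subset `L` of `T^*Q`, with a given smooth structure on it, is a Lagrangian submanifold of
`(T^*Q, ω_Q)`: the inclusion is a smooth embedding, and every tangent space of `L` is equal to its
own orthogonal with respect to `ω_Q`. -/
structure IsLagrangianSubmanifold : Prop where
  isSmoothEmbedding :
    Manifold.IsSmoothEmbedding 𝓘(ℝ, F) (cotangentModel E) ∞ (Subtype.val : L → CotangentBundle E Q)
  tangentSpace_eq_orthogonal : ∀ α : L,
    submanifoldTangentSpace F L α =
      {v | ∀ w ∈ submanifoldTangentSpace F L α, 
        canonicalSymplecticForm (α : CotangentBundle E Q) v w = 0}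

end Submanifold

section Action

variable {EG : Type*} [NormedAddCommGroup EG] [NormedSpace ℝ EG]
  {G : Type*} [TopologicalSpace G] [ChartedSpace EG G] [Group G] [MulAction G Q]

/-- The cotangent lift `Φ_g^{T^*}(α_q) = (TΦ_{g⁻¹})^*(gq)(α_q) ∈ T_{gq}^*Q` of the action of `g`
on `Q`. (The tangent map of `Φ_{g⁻¹}` at `gq` takes values in `T_{g⁻¹gq}Q = T_qQ`.) -/
def cotangentLift (g : G) (α : CotangentBundle E Q) : CotangentBundle E Q :=
  ⟨g • α.1, ContinuousLinearMap.comp (α.2 : TangentSpace 𝓘(ℝ, E) α.1 →L[ℝ] ℝ)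
    (mfderiv 𝓘(ℝ, E) 𝓘(ℝ, E) (fun x : Q ↦ g⁻¹ • x) (g • α.1))⟩

/-- The infinitesimal generator at `q ∈ Q`, as the linear map `ξ ↦ ξ_Q(q)` from the Lie algebra
`𝔤 = T_1G` to `T_qQ`: the tangent map at `1` of `g ↦ g q`. -/
def infinitesimalGenerator (q : Q) :
    GroupLieAlgebra 𝓘(ℝ, EG) G →L[ℝ] TangentSpace 𝓘(ℝ, E) q :=
  mfderiv 𝓘(ℝ, EG) 𝓘(ℝ, E) (fun g : G ↦ g • q) 1

/-- The momentum map `J : T^*Q → 𝔤^*`, `J(α_q)(ξ) = α_q(ξ_Q(q))`. -/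
def momentumMap (α : CotangentBundle E Q) : GroupLieAlgebra 𝓘(ℝ, EG) G →L[ℝ] ℝ :=
  ContinuousLinearMap.comp (α.2 : TangentSpace 𝓘(ℝ, E) α.1 →L[ℝ] ℝ)
    (infinitesimalGenerator (G := G) α.1)

/-- The fundamental vector field `ξ_{T^*Q}` on `T^*Q` generated by `ξ ∈ 𝔤` via the cotangent
lifted action: its value at `α` is the derivative at `1`, in the direction `ξ`, of
`g ↦ Φ_g^{T^*}(α)`. -/
def cotangentGenerator (ξ : GroupLieAlgebra 𝓘(ℝ, EG) G) (α : CotangentBundle E Q) :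
    TangentSpace (cotangentModel E) α :=
  mfderiv 𝓘(ℝ, EG) (cotangentModel E) (fun g : G ↦ cotangentLift g α) 1 ξ

variable (G) in
/-- `L` is `G`-invariant: `Φ_g^{T^*}(L) = L` for all `g ∈ G`. -/
def IsInvariantUnderLift (L : Set (CotangentBundle E Q)) : Prop :=
  ∀ g : G, cotangentLift g '' L = L

variable (G EG) in
/-- `J` is constant along `L`. -/
def MomentumConstantOn (L : Set (CotangentBundle E Q)) : Prop :=
  ∃ μ : GroupLieAlgebra 𝓘(ℝ, EG) G →L[ℝ] ℝ, ∀ α ∈ L, momentumMap α = μ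

variable (G EG) in
/-- Flows on `L` are globally defined: whenever the vector field `ξ_{T^*Q}` is tangent to `L` at
all points of `L`, so that it restricts to a vector field on `L`, this restriction is complete,
that is, through every point of `L` there is an integral curve that is defined for all times and
stays in `L`. -/
def HasCompleteGenerators (F : Type*) [NormedAddCommGroup F] [NormedSpace ℝ F]
    (L : Set (CotangentBundle E Q)) [ChartedSpace F L] : Prop :=
  ∀ ξ : GroupLieAlgebra 𝓘(ℝ, EG) G,
    (∀ α : L, cotangentGenerator ξ (α : CotangentBundle E Q) ∈ submanifoldTangentSpace F L α) →
    ∀ α ∈ L, ∃ γ : ℝ → CotangentBundle E Q, γ 0 = α ∧ (∀ t, γ t ∈ L) ∧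
      IsMIntegralCurve (I := cotangentModel E) γ (cotangentGenerator ξ)

end Action

end Symplectic

end

/-! Write J^ξ for the function α ↦ J(α)(ξ). Everything rests on dJ^ξ = ω(ξ_{T^*Q}, ·)
(`hasModelDerivAt_momentumMap`). Since T_αL is its own ω-orthogonal, ξ_{T^*Q}(α) lies in T_αL
exactly when dJ^ξ vanishes on T_αL (`IsLagrangianSubmanifold.generator_tangent_iff`). So J is
locally constant on L if and only if all generators are tangent to L, and the theorem compares
tangency with invariance.

Invariance implies tangency because the orbit map g ↦ gα then takes values in L; on a connected L,
locally constant means constant.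

Conversely, let all generators be tangent to L. If L is closed, {g | gα ∈ L} is closed, and it is
open by a Grönwall estimate in a slice chart (`eventually_act_mem_of_tangent`), so it is all of the
connected group G. If instead the restricted fields are complete, the integral curve of -ξ from α is
b(t)⁻¹α for small t, with b a left-invariant curve of ξ. The g with g⁻¹L ⊆ L thus form a submonoid
containing a curve through 1 in every direction. It is a neighbourhood of 1
(`Submonoid.mem_nhds_one_of_curves`), and the open subgroup inside it is G. -/

section

open scoped Topology
open Bundle Set Filter

/-! ### Derivatives on manifolds, with tangent spaces read as model spaces -/

section UntypedDerivative

variable {E : Type*} [NormedAddCommGroup E] [NormedSpace ℝ E]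
  {H : Type*} [TopologicalSpace H] {I : ModelWithCorners ℝ E H}
  {M : Type*} [TopologicalSpace M] [ChartedSpace H M]
  {E' : Type*} [NormedAddCommGroup E'] [NormedSpace ℝ E']
  {H' : Type*} [TopologicalSpace H'] {I' : ModelWithCorners ℝ E' H'}
  {M' : Type*} [TopologicalSpace M'] [ChartedSpace H' M']
  {E'' : Type*} [NormedAddCommGroup E''] [NormedSpace ℝ E'']
  {H'' : Type*} [TopologicalSpace H''] {I'' : ModelWithCorners ℝ E'' H''}
  {M'' : Type*} [TopologicalSpace M''] [ChartedSpace H'' M'']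

variable (I I') in
/-- `HasMFDerivAt` with the derivative seen as a map between the model spaces. -/
def HasModelDerivAt (f : M → M') (x : M) (f' : E →L[ℝ] E') : Prop :=
  HasMFDerivAt I I' f x f'

variable (I I') in
/-- `mfderiv` seen as a map between the model spaces. -/
noncomputable def modelDeriv (f : M → M') (x : M) : E →L[ℝ] E' :=
  mfderiv I I' f x

theorem HasModelDerivAt.modelDeriv_eq {f : M → M'} {x : M} {f' : E →L[ℝ] E'}
    (h : HasModelDerivAt I I' f x f') : modelDeriv I I' f x = f' :=
  HasMFDerivAt.mfderiv h

theorem HasModelDerivAt.unique {f : M → M'} {x : M} {f' f'' : E →L[ℝ] E'}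
    (h : HasModelDerivAt I I' f x f') (h' : HasModelDerivAt I I' f x f'') : f' = f'' :=
  hasMFDerivAt_unique h h'

theorem MDifferentiableAt.hasModelDerivAt {f : M → M'} {x : M}
    (h : MDifferentiableAt I I' f x) : HasModelDerivAt I I' f x (modelDeriv I I' f x) :=
  h.hasMFDerivAt

theorem HasModelDerivAt.continuousAt {f : M → M'} {x : M} {f' : E →L[ℝ] E'}
    (h : HasModelDerivAt I I' f x f') : ContinuousAt f x :=
  HasMFDerivAt.continuousAt h

theorem HasModelDerivAt.congr {f g : M → M'} {x : M} {f' : E →L[ℝ] E'}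
    (h : HasModelDerivAt I I' f x f') (hfg : g =ᶠ[𝓝 x] f) : HasModelDerivAt I I' g x f' :=
  HasMFDerivAt.congr_of_eventuallyEq h hfg

theorem HasModelDerivAt.comp {g : M' → M''} {f : M → M'} (x : M) {f' : E →L[ℝ] E'}
    {g' : E' →L[ℝ] E''} (hg : HasModelDerivAt I' I'' g (f x) g')
    (hf : HasModelDerivAt I I' f x f') : HasModelDerivAt I I'' (g ∘ f) x (g'.comp f') :=
  HasMFDerivAt.comp x hg hf

theorem HasModelDerivAt.comp_of_eq {g : M' → M''} {f : M → M'} {x : M} {y : M'}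
    {f' : E →L[ℝ] E'} {g' : E' →L[ℝ] E''} (hg : HasModelDerivAt I' I'' g y g')
    (hf : HasModelDerivAt I I' f x f') (hy : f x = y) :
    HasModelDerivAt I I'' (fun z => g (f z)) x (g'.comp f') := by
  subst hy
  exact HasModelDerivAt.comp x hg hf

theorem hasModelDerivAt_iff_hasFDerivAt {f : E → E'} {x : E} {f' : E →L[ℝ] E'} :
    HasModelDerivAt 𝓘(ℝ, E) 𝓘(ℝ, E') f x f' ↔ HasFDerivAt f f' x :=
  hasMFDerivAt_iff_hasFDerivAt

theorem hasModelDerivAt_id (x : M) : HasModelDerivAt I I (fun y : M => y) x (.id ℝ E) :=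
  hasMFDerivAt_id x

theorem hasModelDerivAt_const (c : M') (x : M) : HasModelDerivAt I I' (fun _ : M => c) x 0 :=
  hasMFDerivAt_const c x

theorem HasModelDerivAt.prodMk {f : M → M'} {g : M → M''} {x : M} {f' : E →L[ℝ] E'}
    {g' : E →L[ℝ] E''} (hf : HasModelDerivAt I I' f x f') (hg : HasModelDerivAt I I'' g x g') :
    HasModelDerivAt I (I'.prod I'') (fun y => (f y, g y)) x (f'.prod g') :=
  HasMFDerivAt.prodMk hf hg

/-- The tangent space at `x` is identified with the model space through the preferred chart at `x`
itself. This removes the chart derivative from every computation made at the base point. -/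
theorem hasModelDerivAt_extChartAt_self [IsManifold I 1 M] (x : M) :
    HasModelDerivAt I 𝓘(ℝ, E) (extChartAt I x) x (.id ℝ E) := by
  have h := hasMFDerivAt_extChartAt (I := I) (mem_chart_source H x)
  have h' := h.mfderiv.symm.trans mfderiv_extChartAt_self
  rw [h'] at h
  exact h

theorem hasModelDerivAt_extChartAt [IsManifold I 1 M] {x y : M}
    (hy : y ∈ (extChartAt I x).source) :
    HasModelDerivAt I 𝓘(ℝ, E) (extChartAt I x) y (modelDeriv I 𝓘(ℝ, E) (extChartAt I x) y) :=
  (mdifferentiableAt_extChartAt (by simpa using hy)).hasModelDerivAt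

theorem hasModelDerivAt_extChartAt_symm [IsManifold I 1 M] [I.Boundaryless] {x : M} {y : E}
    (hy : y ∈ (extChartAt I x).target) :
    HasModelDerivAt 𝓘(ℝ, E) I (extChartAt I x).symm y
      (modelDeriv 𝓘(ℝ, E) I (extChartAt I x).symm y) := by
  refine MDifferentiableAt.hasModelDerivAt ?_
  have := mdifferentiableWithinAt_extChartAt_symm (I := I) hy
  rwa [ModelWithCorners.range_eq_univ, mdifferentiableWithinAt_univ] at this

theorem modelDeriv_extChartAt_comp_symm [IsManifold I 1 M] [I.Boundaryless] {x : M} {y : E}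
    (hy : y ∈ (extChartAt I x).target) :
    (modelDeriv I 𝓘(ℝ, E) (extChartAt I x) ((extChartAt I x).symm y)).comp
      (modelDeriv 𝓘(ℝ, E) I (extChartAt I x).symm y) = .id ℝ E := by
  refine ((hasModelDerivAt_extChartAt ((extChartAt I x).map_target hy)).comp y
    (hasModelDerivAt_extChartAt_symm hy)).unique ((hasModelDerivAt_id y).congr ?_)
  filter_upwards [extChartAt_target_mem_nhds' hy] with z hz
  exact (extChartAt I x).right_inv hz

theorem modelDeriv_extChartAt_symm_comp [IsManifold I 1 M] [I.Boundaryless] {x y : M}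
    (hy : y ∈ (extChartAt I x).source) :
    (modelDeriv 𝓘(ℝ, E) I (extChartAt I x).symm (extChartAt I x y)).comp
      (modelDeriv I 𝓘(ℝ, E) (extChartAt I x) y) = .id ℝ E := by
  refine ((hasModelDerivAt_extChartAt_symm ((extChartAt I x).map_source hy)).comp y
    (hasModelDerivAt_extChartAt hy)).unique ((hasModelDerivAt_id y).congr ?_)
  filter_upwards [extChartAt_source_mem_nhds' hy] with z hz
  exact (extChartAt I x).left_inv hz

end UntypedDerivative

/-! ### Canonical coordinates on the cotangent bundle -/

section CotangentCharts

variable {E : Type*} [NormedAddCommGroup E] [NormedSpace ℝ E]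
  {Q : Type*} [TopologicalSpace Q] [ChartedSpace E Q]

/-- The covector `p` at `q`, where `p` is a form on the model space. -/
def cotangentMk (q : Q) (p : E →L[ℝ] ℝ) : CotangentBundle E Q := ⟨q, p⟩

/-- The fibre component of a covector, as a form on the model space. -/
def cotangentSnd (α : CotangentBundle E Q) : E →L[ℝ] ℝ := α.2

@[simp] theorem cotangentMk_proj (q : Q) (p : E →L[ℝ] ℝ) : (cotangentMk q p).proj = q := rfl

@[simp] theorem cotangentSnd_cotangentMk (q : Q) (p : E →L[ℝ] ℝ) :
    cotangentSnd (cotangentMk q p) = p := rfl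

theorem cotangentMk_proj_snd (α : CotangentBundle E Q) :
    cotangentMk α.proj (cotangentSnd α) = α := rfl

variable [IsManifold 𝓘(ℝ, E) ∞ Q]

theorem cotangent_extChartAt_source (α₀ : CotangentBundle E Q) :
    (extChartAt (cotangentModel E) α₀).source =
      {α | α.proj ∈ (extChartAt 𝓘(ℝ, E) α₀.proj).source} := by
  rw [FiberBundle.extChartAt]
  ext α
  simp [hom_trivializationAt_apply]

theorem cotangent_extChartAt_target (α₀ : CotangentBundle E Q) :
    (extChartAt (cotangentModel E) α₀).target =
      (extChartAt 𝓘(ℝ, E) α₀.proj).target ×ˢ univ := by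
  rw [FiberBundle.extChartAt_target]
  congr 1
  ext x
  constructor
  · exact fun h => h.1
  · intro h
    refine ⟨h, ?_⟩
    have := (extChartAt 𝓘(ℝ, E) α₀.proj).map_target h
    simpa [hom_trivializationAt_baseSet] using this

theorem cotangent_extChartAt_apply (α₀ α : CotangentBundle E Q)
    (h : α.proj ∈ (extChartAt 𝓘(ℝ, E) α₀.proj).source) :
    extChartAt (cotangentModel E) α₀ α = (extChartAt 𝓘(ℝ, E) α₀.proj α.proj,
      (cotangentSnd α).comp
        (modelDeriv 𝓘(ℝ, E) 𝓘(ℝ, E) (extChartAt 𝓘(ℝ, E) α₀.proj).symm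
          (extChartAt 𝓘(ℝ, E) α₀.proj α.proj))) := by
  have h' : α.proj ∈ (chartAt E α₀.proj).source := by simpa using h
  have := TangentBundle.symmL_trivializationAt (I := 𝓘(ℝ, E)) h'
  rw [ModelWithCorners.range_eq_univ, mfderivWithin_univ] at this
  rw [FiberBundle.extChartAt]
  refine Prod.ext rfl ?_
  ext v
  have key : ∀ A : E →L[ℝ] TangentSpace 𝓘(ℝ, E) α.proj,
      Trivialization.symmL ℝ (trivializationAt E (TangentSpace 𝓘(ℝ, E)) α₀.proj) α.proj = A →
      ContinuousLinearMap.inCoordinates E (TangentSpace 𝓘(ℝ, E)) ℝ (Trivial Q ℝ)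
        α₀.proj α.proj α₀.proj α.proj α.2 v = α.2 (A v) := by
    rintro A rfl
    simp [ContinuousLinearMap.inCoordinates]
  exact key _ this

theorem cotangent_extChartAt_symm_apply (α₀ : CotangentBundle E Q) (x : E) (p : E →L[ℝ] ℝ)
    (h : x ∈ (extChartAt 𝓘(ℝ, E) α₀.proj).target) :
    (extChartAt (cotangentModel E) α₀).symm (x, p) =
      cotangentMk ((extChartAt 𝓘(ℝ, E) α₀.proj).symm x)
        (p.comp (modelDeriv 𝓘(ℝ, E) 𝓘(ℝ, E) (extChartAt 𝓘(ℝ, E) α₀.proj)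
          ((extChartAt 𝓘(ℝ, E) α₀.proj).symm x))) := by
  have hs := (extChartAt 𝓘(ℝ, E) α₀.proj).map_target h
  set β := cotangentMk ((extChartAt 𝓘(ℝ, E) α₀.proj).symm x)
        (p.comp (modelDeriv 𝓘(ℝ, E) 𝓘(ℝ, E) (extChartAt 𝓘(ℝ, E) α₀.proj)
          ((extChartAt 𝓘(ℝ, E) α₀.proj).symm x))) with hβ
  have hβs : β ∈ (extChartAt (cotangentModel E) α₀).source := by
    rw [cotangent_extChartAt_source]; exact hs
  -- It suffices to apply the chart to the proposed preimage and to recover (x, p).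
  rw [← (extChartAt (cotangentModel E) α₀).left_inv hβs, cotangent_extChartAt_apply _ _ hs]
  congr 1
  have h1 : extChartAt 𝓘(ℝ, E) α₀.proj β.proj = x := (extChartAt 𝓘(ℝ, E) α₀.proj).right_inv h
  rw [h1, hβ, cotangentSnd_cotangentMk, ContinuousLinearMap.comp_assoc,
    modelDeriv_extChartAt_comp_symm h, ContinuousLinearMap.comp_id]

end CotangentCharts

/-! ### The tautological form is p dq, and ω is the standard form -/

section CanonicalForm

theorem DifferentiableAt.continuousAlternatingMap_ofSubsingleton
    {V W : Type*} [NormedAddCommGroup V] [NormedSpace ℝ V] [NormedAddCommGroup W] [NormedSpace ℝ W]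
    {f : W → V →L[ℝ] ℝ} {z : W} (hf : DifferentiableAt ℝ f z) :
    DifferentiableAt ℝ
      (fun y => ContinuousAlternatingMap.ofSubsingleton ℝ V ℝ (0 : Fin 1) (f y)) z :=
  (ContinuousAlternatingMap.ofSubsingletonLIE (𝕜 := ℝ) (E := V) (F := ℝ)
    (i := (0 : Fin 1))).toContinuousLinearEquiv.differentiableAt.comp z hf

variable {E : Type*} [NormedAddCommGroup E] [NormedSpace ℝ E]
  {Q : Type*} [TopologicalSpace Q] [ChartedSpace E Q] [IsManifold 𝓘(ℝ, E) ∞ Q]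

theorem hasModelDerivAt_cotangent_proj (α : CotangentBundle E Q) :
    HasModelDerivAt (cotangentModel E) 𝓘(ℝ, E)
      (TotalSpace.proj : CotangentBundle E Q → Q) α
      (modelDeriv (cotangentModel E) 𝓘(ℝ, E) (TotalSpace.proj : CotangentBundle E Q → Q) α) :=
  ((contMDiff_proj (n := 1) (CotangentSpace E Q)) α |>.mdifferentiableAt
    one_ne_zero).hasModelDerivAt

theorem localOneForm_tautologicalForm (α₀ : CotangentBundle E Q) (x : E) (p : E →L[ℝ] ℝ)
    (h : x ∈ (extChartAt 𝓘(ℝ, E) α₀.proj).target) (w : E × (E →L[ℝ] ℝ)) :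
    localOneForm (cotangentModel E) tautologicalForm α₀ (x, p) w = p w.1 := by
  have hxp : (x, p) ∈ (extChartAt (cotangentModel E) α₀).target := by
    rw [cotangent_extChartAt_target]; exact ⟨h, mem_univ _⟩
  have h1 := (hasModelDerivAt_cotangent_proj _).comp _
    (hasModelDerivAt_extChartAt_symm hxp)
  -- In charts, the bundle projection is the projection to the first factor.
  have h2 := h1.unique (f'' := (modelDeriv 𝓘(ℝ, E) 𝓘(ℝ, E)
    (extChartAt 𝓘(ℝ, E) α₀.proj).symm x).comp (.fst ℝ E (E →L[ℝ] ℝ))) <| by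
    refine ((hasModelDerivAt_extChartAt_symm h).comp_of_eq (f := Prod.fst)
      (x := (x, p)) (hasModelDerivAt_iff_hasFDerivAt.2 hasFDerivAt_fst) rfl).congr ?_
    filter_upwards [extChartAt_target_mem_nhds' hxp] with z hz
    rw [cotangent_extChartAt_target] at hz
    simp only [Function.comp]
    rw [cotangent_extChartAt_symm_apply α₀ z.1 z.2 hz.1]
    rfl
  have h3 : localOneForm (cotangentModel E) tautologicalForm α₀ (x, p) w =
    cotangentSnd ((extChartAt (cotangentModel E) α₀).symm (x, p))
      (((modelDeriv (cotangentModel E) 𝓘(ℝ, E) (TotalSpace.proj : CotangentBundle E Q → Q)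
        ((extChartAt (cotangentModel E) α₀).symm (x, p))).comp
      (modelDeriv 𝓘(ℝ, E × (E →L[ℝ] ℝ)) (cotangentModel E)
        (extChartAt (cotangentModel E) α₀).symm (x, p))) w) := rfl
  rw [h3, h2, cotangent_extChartAt_symm_apply α₀ x p h, cotangentSnd_cotangentMk]
  have h4 := congrArg (fun A : E →L[ℝ] E => p (A w.1)) (modelDeriv_extChartAt_comp_symm h)
  exact h4

/-- The canonical symplectic form in canonical coordinates. -/
theorem canonicalSymplecticForm_apply (α : CotangentBundle E Q) (v w : E × (E →L[ℝ] ℝ)) :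
    canonicalSymplecticForm α v w = w.2 v.1 - v.2 w.1 := by
  set z := extChartAt (cotangentModel E) α α with hz
  have hzt : z ∈ (extChartAt (cotangentModel E) α).target := mem_extChartAt_target α
  let ψ : E × (E →L[ℝ] ℝ) → (E × (E →L[ℝ] ℝ)) [⋀^Fin 1]→L[ℝ] ℝ := fun y =>
    ContinuousAlternatingMap.ofSubsingleton ℝ (E × (E →L[ℝ] ℝ)) ℝ (0 : Fin 1)
      (y.2.comp (.fst ℝ E (E →L[ℝ] ℝ)))
  have hev : (fun y => ContinuousAlternatingMap.ofSubsingleton ℝ (E × (E →L[ℝ] ℝ)) ℝ (0 : Fin 1)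
      (localOneForm (cotangentModel E) tautologicalForm α y)) =ᶠ[𝓝 z] ψ := by
    filter_upwards [extChartAt_target_mem_nhds' hzt] with y hy
    rw [cotangent_extChartAt_target] at hy
    refine congrArg _ (ContinuousLinearMap.ext fun u => ?_)
    exact localOneForm_tautologicalForm α y.1 y.2 hy.1 u
  have hψ : DifferentiableAt ℝ ψ z := by
    have h1 : DifferentiableAt ℝ (fun y : E × (E →L[ℝ] ℝ) =>
      y.2.comp (ContinuousLinearMap.fst ℝ E (E →L[ℝ] ℝ))) z := by fun_prop
    exact h1.continuousAlternatingMap_ofSubsingleton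
  have hd : ∀ u u' : E × (E →L[ℝ] ℝ),
      fderiv ℝ (fun y : E × (E →L[ℝ] ℝ) => y.2 u.1) z u' = u'.2 u.1 := fun u u' => by
    have : HasFDerivAt (fun y : E × (E →L[ℝ] ℝ) => y.2 u.1)
      ((ContinuousLinearMap.apply ℝ ℝ u.1).comp (.snd ℝ E (E →L[ℝ] ℝ))) z :=
      ((ContinuousLinearMap.apply ℝ ℝ u.1).comp (.snd ℝ E (E →L[ℝ] ℝ))).hasFDerivAt
    rw [this.fderiv]; rfl
  have h1 : canonicalSymplecticForm α v w = - extDeriv (fun y =>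
      ContinuousAlternatingMap.ofSubsingleton ℝ (E × (E →L[ℝ] ℝ)) ℝ (0 : Fin 1)
      (localOneForm (cotangentModel E) tautologicalForm α y)) z
      ![modelDeriv (cotangentModel E) 𝓘(ℝ, E × (E →L[ℝ] ℝ))
          (extChartAt (cotangentModel E) α) α v,
        modelDeriv (cotangentModel E) 𝓘(ℝ, E × (E →L[ℝ] ℝ))
          (extChartAt (cotangentModel E) α) α w] := rfl
  -- At its own base point the chart has derivative the identity, so dθ(v, w) is the directional
  -- derivative along v of p(w.1) minus that along w of p(v.1).
  rw [h1, hev.extDeriv_eq, (hasModelDerivAt_extChartAt_self α).modelDeriv_eq, extDeriv_apply hψ]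
  have h2 : ∀ u : Fin 1 → E × (E →L[ℝ] ℝ), ∀ y, ψ y u = y.2 (u 0).1 := fun u y => rfl
  simp [Fin.sum_univ_two, h2, Fin.removeNth, hd, sub_eq_add_neg]

end CanonicalForm

/-! ### Smooth dependence of derivatives on parameters -/

section ParametricDerivative

variable {E : Type*} [NormedAddCommGroup E] [NormedSpace ℝ E]
  {E' : Type*} [NormedAddCommGroup E'] [NormedSpace ℝ E']
  {EN : Type*} [NormedAddCommGroup EN] [NormedSpace ℝ EN]
  {HN : Type*} [TopologicalSpace HN] {J : ModelWithCorners ℝ EN HN}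
  {N : Type*} [TopologicalSpace N] [ChartedSpace HN N] [IsManifold J 1 N]

/-- Tangent coordinates are trivial on model spaces, so the manifold statement reduces to `fderiv`.
It serves the fibre part of the cotangent lift, which contains the base derivative of g⁻¹. -/
theorem ContMDiffAt.fderiv_of_uncurry {x₀ : N} {f : N → E → E'} {g : N → E}
    (hf : ContMDiffAt (J.prod 𝓘(ℝ, E)) 𝓘(ℝ, E') ∞ (Function.uncurry f) (x₀, g x₀))
    (hg : ContMDiffAt J 𝓘(ℝ, E) ∞ g x₀) :
    ContMDiffAt J 𝓘(ℝ, E →L[ℝ] E') ∞ (fun x => fderiv ℝ (f x) (g x)) x₀ := by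
  have := hf.mfderiv (m := ∞) f g hg (by simp)
  refine this.congr_of_eventuallyEq (Eventually.of_forall fun x => ?_)
  exact mfderiv_eq_fderiv.symm.trans (congrFun (inTangentCoordinates_model_space
    (I := 𝓘(ℝ, E)) (I' := 𝓘(ℝ, E')) g (fun x => f x (g x))
    (fun x => (mfderiv 𝓘(ℝ, E) 𝓘(ℝ, E') (f x) (g x) : E →L[ℝ] E')) x₀) x).symm

end ParametricDerivative

/-! ### The cotangent lift is a smooth action -/

section LiftedAction

variable {E : Type*} [NormedAddCommGroup E] [NormedSpace ℝ E]
  {Q : Type*} [TopologicalSpace Q] [ChartedSpace E Q] [IsManifold 𝓘(ℝ, E) ∞ Q]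
  {EG : Type*} [NormedAddCommGroup EG] [NormedSpace ℝ EG]
  {G : Type*} [TopologicalSpace G] [ChartedSpace EG G] [Group G] [LieGroup 𝓘(ℝ, EG) ∞ G]
  [MulAction G Q] [ContMDiffSMul 𝓘(ℝ, EG) 𝓘(ℝ, E) ∞ G Q]

omit [IsManifold 𝓘(ℝ, E) ∞ Q] [TopologicalSpace G] in
theorem cotangentLift_eq (g : G) (α : CotangentBundle E Q) :
    cotangentLift g α = cotangentMk (g • α.proj) ((cotangentSnd α).comp
      (modelDeriv 𝓘(ℝ, E) 𝓘(ℝ, E) (fun x : Q => g⁻¹ • x) (g • α.proj))) := rfl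

variable (EG) in
include EG in
omit [IsManifold 𝓘(ℝ, E) ∞ Q] [LieGroup 𝓘(ℝ, EG) ∞ G] in
theorem contMDiff_smul_left (g : G) : ContMDiff 𝓘(ℝ, E) 𝓘(ℝ, E) ∞ (fun x : Q => g • x) :=
  (contMDiff_smul (I := 𝓘(ℝ, EG)) (I' := 𝓘(ℝ, E)) (n := ∞) (G := G) (M := Q)).comp
    (contMDiff_const.prodMk contMDiff_id)

variable (EG) in
include EG in
omit [IsManifold 𝓘(ℝ, E) ∞ Q] [LieGroup 𝓘(ℝ, EG) ∞ G] in
theorem hasModelDerivAt_smul_left (g : G) (x : Q) :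
    HasModelDerivAt 𝓘(ℝ, E) 𝓘(ℝ, E) (fun x : Q => g • x) x
      (modelDeriv 𝓘(ℝ, E) 𝓘(ℝ, E) (fun x : Q => g • x) x) :=
  ((contMDiff_smul_left EG g x).mdifferentiableAt (by simp)).hasModelDerivAt

omit [IsManifold 𝓘(ℝ, E) ∞ Q] [TopologicalSpace G] in
theorem cotangentLift_one (α : CotangentBundle E Q) : cotangentLift (1 : G) α = α := by
  have h : modelDeriv 𝓘(ℝ, E) 𝓘(ℝ, E) (fun x : Q => (1 : G)⁻¹ • x) ((1 : G) • α.proj) =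
      .id ℝ E :=
    ((hasModelDerivAt_id ((1 : G) • α.proj)).congr
      (Eventually.of_forall fun x => by simp)).modelDeriv_eq
  rw [cotangentLift_eq, h, ContinuousLinearMap.comp_id, one_smul, cotangentMk_proj_snd]

variable (EG) in
include EG in
omit [IsManifold 𝓘(ℝ, E) ∞ Q] [LieGroup 𝓘(ℝ, EG) ∞ G] in
-- This is the chain rule for (gh)⁻¹ = h⁻¹g⁻¹.
theorem cotangentLift_mul (g h : G) (α : CotangentBundle E Q) :
    cotangentLift (g * h) α = cotangentLift g (cotangentLift h α) := by
  rw [cotangentLift_eq, cotangentLift_eq g, cotangentLift_eq h]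
  simp only [cotangentMk_proj, cotangentSnd_cotangentMk, mul_smul]
  congr 1
  rw [ContinuousLinearMap.comp_assoc]
  congr 1
  refine HasModelDerivAt.modelDeriv_eq ?_
  refine ((hasModelDerivAt_smul_left EG h⁻¹ (h • α.proj)).comp_of_eq
    (hasModelDerivAt_smul_left EG g⁻¹ (g • h • α.proj)) (by simp)).congr
      (Eventually.of_forall fun x => by simp [mul_smul])

include EG in
omit [LieGroup 𝓘(ℝ, EG) ∞ G] in
variable (EG) in
/-- The lifted action in canonical coordinates. -/
theorem extChartAt_cotangentLift (α₀ α₁ α : CotangentBundle E Q) (g : G)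
    (h0 : α.proj ∈ (extChartAt 𝓘(ℝ, E) α₀.proj).source)
    (h1 : g • α.proj ∈ (extChartAt 𝓘(ℝ, E) α₁.proj).source) :
    extChartAt (cotangentModel E) α₁ (cotangentLift g α) =
      (extChartAt 𝓘(ℝ, E) α₁.proj (g • α.proj),
        (extChartAt (cotangentModel E) α₀ α).2.comp
          (fderiv ℝ (fun y => extChartAt 𝓘(ℝ, E) α₀.proj
            (g⁻¹ • (extChartAt 𝓘(ℝ, E) α₁.proj).symm y))
            (extChartAt 𝓘(ℝ, E) α₁.proj (g • α.proj)))) := by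
  rw [cotangent_extChartAt_apply α₁ _ h1, cotangent_extChartAt_apply α₀ _ h0, cotangentLift_eq,
    cotangentMk_proj, cotangentSnd_cotangentMk]
  ext1
  · rfl
  have hq : (extChartAt 𝓘(ℝ, E) α₁.proj).symm
      (extChartAt 𝓘(ℝ, E) α₁.proj (g • α.proj)) = g • α.proj :=
    (extChartAt 𝓘(ℝ, E) α₁.proj).left_inv h1
  have hd := ((hasModelDerivAt_extChartAt h0).comp_of_eq
    ((hasModelDerivAt_smul_left EG g⁻¹ (g • α.proj)).comp_of_eq (hasModelDerivAt_extChartAt_symm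
      ((extChartAt 𝓘(ℝ, E) α₁.proj).map_source h1)) hq) (by rw [hq, inv_smul_smul]))
  rw [hasModelDerivAt_iff_hasFDerivAt] at hd
  rw [hd.fderiv]
  ext v
  -- The two sides differ by the derivative of the chart at `α₀` followed by that of its inverse,
  -- which cancel.
  have := congrArg (fun A : E →L[ℝ] E => cotangentSnd α (A
    (modelDeriv 𝓘(ℝ, E) 𝓘(ℝ, E) (fun x : Q => g⁻¹ • x) (g • α.proj)
      (modelDeriv 𝓘(ℝ, E) 𝓘(ℝ, E) (extChartAt 𝓘(ℝ, E) α₁.proj).symm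
        (extChartAt 𝓘(ℝ, E) α₁.proj (g • α.proj)) v)))) (modelDeriv_extChartAt_symm_comp h0)
  exact this.symm

/-- In canonical coordinates the lift is (gq, p ∘ D(g⁻¹)), and each ingredient is smooth jointly in
g and α. -/
theorem contMDiff_cotangentLift :
    ContMDiff (𝓘(ℝ, EG).prod (cotangentModel E)) (cotangentModel E) ∞
      (fun z : G × CotangentBundle E Q => cotangentLift z.1 z.2) := by
  rintro ⟨g₀, α₀⟩
  set α₁ := cotangentLift g₀ α₀ with hα₁
  have hproj : ContMDiff (cotangentModel E) 𝓘(ℝ, E) ∞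
    (TotalSpace.proj : CotangentBundle E Q → Q) := contMDiff_proj (CotangentSpace E Q)
  have hbase : ContMDiff (𝓘(ℝ, EG).prod (cotangentModel E)) 𝓘(ℝ, E) ∞
      (fun z : G × CotangentBundle E Q => z.1 • z.2.proj) :=
    (contMDiff_smul (I := 𝓘(ℝ, EG)) (I' := 𝓘(ℝ, E)) (n := ∞) (G := G) (M := Q)).comp
      (contMDiff_fst.prodMk (hproj.comp contMDiff_snd))
  have hχ : ContMDiffAt (𝓘(ℝ, EG).prod (cotangentModel E)) 𝓘(ℝ, E) ∞
      (fun z : G × CotangentBundle E Q => extChartAt 𝓘(ℝ, E) α₁.proj (z.1 • z.2.proj))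
      (g₀, α₀) := by
    refine ContMDiffAt.comp (g₀, α₀) (g := extChartAt 𝓘(ℝ, E) α₁.proj) ?_ hbase.contMDiffAt
    exact contMDiffAt_extChartAt
  have hψ : ContMDiffAt (𝓘(ℝ, EG).prod (cotangentModel E)) 𝓘(ℝ, E →L[ℝ] ℝ) ∞
      (fun z : G × CotangentBundle E Q => (extChartAt (cotangentModel E) α₀ z.2).2)
      (g₀, α₀) := by
    have h := (contMDiffAt_extChartAt (I := cotangentModel E) (n := ∞) (x := α₀))
    have h2 : ContMDiffAt (cotangentModel E) 𝓘(ℝ, E →L[ℝ] ℝ) ∞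
      (fun α => (extChartAt (cotangentModel E) α₀ α).2) α₀ :=
      (contDiff_snd.contMDiff.contMDiffAt).comp α₀ h
    exact ContMDiffAt.comp (g₀, α₀) (f := Prod.snd)
      (g := fun α => (extChartAt (cotangentModel E) α₀ α).2) h2 contMDiffAt_snd
  have hK : ContMDiffAt ((𝓘(ℝ, EG).prod (cotangentModel E)).prod 𝓘(ℝ, E)) 𝓘(ℝ, E) ∞
      (fun w : (G × CotangentBundle E Q) × E => extChartAt 𝓘(ℝ, E) α₀.proj
            (w.1.1⁻¹ • (extChartAt 𝓘(ℝ, E) α₁.proj).symm w.2))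
      ((g₀, α₀), extChartAt 𝓘(ℝ, E) α₁.proj (g₀ • α₀.proj)) := by
    have hq : (extChartAt 𝓘(ℝ, E) α₁.proj).symm
        (extChartAt 𝓘(ℝ, E) α₁.proj (g₀ • α₀.proj)) = g₀ • α₀.proj :=
      extChartAt_to_inv (I := 𝓘(ℝ, E)) (g₀ • α₀.proj)
    have hs : ContMDiffAt 𝓘(ℝ, E) 𝓘(ℝ, E) ∞ (extChartAt 𝓘(ℝ, E) α₁.proj).symm
        (extChartAt 𝓘(ℝ, E) α₁.proj (g₀ • α₀.proj)) :=
      (contMDiffOn_extChartAt_symm α₁.proj).contMDiffAt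
        (extChartAt_target_mem_nhds (I := 𝓘(ℝ, E)) α₁.proj)
    refine ContMDiffAt.comp_of_eq (y := α₀.proj) (g := extChartAt 𝓘(ℝ, E) α₀.proj)
      contMDiffAt_extChartAt ?_ (by rw [hq, inv_smul_smul])
    refine ContMDiffAt.comp (g := fun p : G × Q => p.1 • p.2)
      (f := fun w : (G × CotangentBundle E Q) × E =>
        (w.1.1⁻¹, (extChartAt 𝓘(ℝ, E) α₁.proj).symm w.2)) _
      (contMDiff_smul (I := 𝓘(ℝ, EG)) (I' := 𝓘(ℝ, E)) (n := ∞) (G := G)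
      (M := Q)).contMDiffAt ?_
    exact ((contMDiff_inv 𝓘(ℝ, EG) ∞).contMDiffAt.comp _ (contMDiffAt_fst.comp _
      contMDiffAt_fst)).prodMk (ContMDiffAt.comp (f := Prod.snd)
        (g := (extChartAt 𝓘(ℝ, E) α₁.proj).symm) _ hs contMDiffAt_snd)
  have hD := ContMDiffAt.fderiv_of_uncurry (f := fun (z : G × CotangentBundle E Q) y =>
    extChartAt 𝓘(ℝ, E) α₀.proj (z.1⁻¹ • (extChartAt 𝓘(ℝ, E) α₁.proj).symm y)) hK hχ
  have hnear : ∀ᶠ z : G × CotangentBundle E Q in 𝓝 (g₀, α₀),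
      z.2.proj ∈ (extChartAt 𝓘(ℝ, E) α₀.proj).source ∧
      z.1 • z.2.proj ∈ (extChartAt 𝓘(ℝ, E) α₁.proj).source :=
    ((hproj.continuous.comp continuous_snd).continuousAt.eventually_mem
      (extChartAt_source_mem_nhds (I := 𝓘(ℝ, E)) α₀.proj)).and
    (hbase.continuous.continuousAt.eventually_mem
      (extChartAt_source_mem_nhds (I := 𝓘(ℝ, E)) (g₀ • α₀.proj)))
  have hloc : ContMDiffAt (𝓘(ℝ, EG).prod (cotangentModel E)) 𝓘(ℝ, E × (E →L[ℝ] ℝ)) ∞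
      (fun z : G × CotangentBundle E Q =>
        extChartAt (cotangentModel E) α₁ (cotangentLift z.1 z.2)) (g₀, α₀) := by
    refine (hχ.prodMk_space (hψ.clm_comp hD)).congr_of_eventuallyEq ?_
    filter_upwards [hnear] with z hz
    exact extChartAt_cotangentLift EG α₀ α₁ z.2 z.1 hz.1 hz.2
  have hback : ContMDiffAt (𝓘(ℝ, EG).prod (cotangentModel E)) (cotangentModel E) ∞
      (fun z : G × CotangentBundle E Q => (extChartAt (cotangentModel E) α₁).symm
        (extChartAt (cotangentModel E) α₁ (cotangentLift z.1 z.2))) (g₀, α₀) :=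
    ((contMDiffOn_extChartAt_symm α₁).contMDiffAt
      (extChartAt_target_mem_nhds (I := cotangentModel E) α₁)).comp (g₀, α₀) hloc
  refine hback.congr_of_eventuallyEq ?_
  filter_upwards [hnear] with z hz
  refine ((extChartAt (cotangentModel E) α₁).left_inv ?_).symm
  rw [cotangent_extChartAt_source]
  exact hz.2
end LiftedAction

/-! ### Symmetry of mixed partial derivatives -/

section MixedPartials

variable {E₁ E₂ E₃ : Type*} [NormedAddCommGroup E₁] [NormedSpace ℝ E₁]
  [NormedAddCommGroup E₂] [NormedSpace ℝ E₂] [NormedAddCommGroup E₃] [NormedSpace ℝ E₃]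

/-- Both maps have a block of the symmetric second derivative of `f` as derivative. With `y` in the
group and `x` in Q, this equates the linearised generator on Q with the derivative at 1 of the
tangent action. -/
theorem ContDiffAt.exists_hasFDerivAt_mixed_partials {f : E₁ × E₂ → E₃} {a : E₁} {b : E₂}
    (hf : ContDiffAt ℝ ∞ f (a, b)) :
    ∃ B : E₁ →L[ℝ] E₂ →L[ℝ] E₃,
      HasFDerivAt (fun y => fderiv ℝ (fun x => f (y, x)) b) B a ∧
      HasFDerivAt (fun x => fderiv ℝ (fun y => f (y, x)) a) B.flip b := by
  have hsymm : IsSymmSndFDerivAt ℝ f (a, b) := hf.isSymmSndFDerivAt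
    (by simpa using ENat.LEInfty.out)
  have hdiff : ∀ᶠ z in 𝓝 (a, b), DifferentiableAt ℝ f z :=
    ((hf.of_le (m := 1) ENat.LEInfty.out).eventually (by simp)).mono fun z hz =>
      hz.differentiableAt one_ne_zero
  have hD : HasFDerivAt (fderiv ℝ f) (fderiv ℝ (fderiv ℝ f) (a, b)) (a, b) :=
    ((hf.fderiv_right (m := 1)
      (by rw [one_add_one_eq_two]; exact ENat.LEInfty.out)).differentiableAt
        one_ne_zero).hasFDerivAt
  have hl : HasFDerivAt (fun y : E₁ => (y, b)) (.inl ℝ E₁ E₂) a := hasFDerivAt_prodMk_left a b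
  have hr : HasFDerivAt (fun x : E₂ => (a, x)) (.inr ℝ E₁ E₂) b := hasFDerivAt_prodMk_right a b
  have h1 := ((ContinuousLinearMap.compL ℝ E₂ (E₁ × E₂) E₃).flip
    (.inr ℝ E₁ E₂)).hasFDerivAt.comp a (hD.comp a hl)
  have h2 := ((ContinuousLinearMap.compL ℝ E₁ (E₁ × E₂) E₃).flip
    (.inl ℝ E₁ E₂)).hasFDerivAt.comp b (hD.comp b hr)
  refine ⟨_, h1.congr_of_eventuallyEq ?_, (h2.congr_of_eventuallyEq ?_).congr_fderiv ?_⟩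
  · filter_upwards [hl.continuousAt.eventually hdiff] with y hy
    exact (hy.hasFDerivAt.comp b (hasFDerivAt_prodMk_right y b)).fderiv
  · filter_upwards [hr.continuousAt.eventually hdiff] with x hx
    exact (hx.hasFDerivAt.comp a (hasFDerivAt_prodMk_left a x)).fderiv
  · ext u v
    exact hsymm.eq _ _

end MixedPartials

/-! ### The momentum map identity dJ^ξ = ω(ξ_{T^*Q}, ·) -/

section Generator

variable {E : Type*} [NormedAddCommGroup E] [NormedSpace ℝ E]
  {Q : Type*} [TopologicalSpace Q] [ChartedSpace E Q] [IsManifold 𝓘(ℝ, E) ∞ Q]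
  {EG : Type*} [NormedAddCommGroup EG] [NormedSpace ℝ EG]
  {G : Type*} [TopologicalSpace G] [ChartedSpace EG G] [Group G] [LieGroup 𝓘(ℝ, EG) ∞ G]
  [MulAction G Q] [ContMDiffSMul 𝓘(ℝ, EG) 𝓘(ℝ, E) ∞ G Q]

variable (EG G) in
theorem hasModelDerivAt_extChartAt_symm_one :
    HasModelDerivAt 𝓘(ℝ, EG) 𝓘(ℝ, EG) (extChartAt 𝓘(ℝ, EG) (1 : G)).symm
      (extChartAt 𝓘(ℝ, EG) (1 : G) 1) (.id ℝ EG) := by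
  have h := modelDeriv_extChartAt_symm_comp (I := 𝓘(ℝ, EG))
    (mem_extChartAt_source (I := 𝓘(ℝ, EG)) (1 : G))
  rw [(hasModelDerivAt_extChartAt_self (1 : G)).modelDeriv_eq, ContinuousLinearMap.comp_id] at h
  rw [← h]
  exact hasModelDerivAt_extChartAt_symm (mem_extChartAt_target (1 : G))

variable (EG) in
omit [IsManifold 𝓘(ℝ, E) ∞ Q] [LieGroup 𝓘(ℝ, EG) ∞ G] in
theorem hasModelDerivAt_orbit (q : Q) :
    HasModelDerivAt 𝓘(ℝ, EG) 𝓘(ℝ, E) (fun g : G => g • q) 1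
      (modelDeriv 𝓘(ℝ, EG) 𝓘(ℝ, E) (fun g : G => g • q) 1) :=
  (((contMDiff_smul (I := 𝓘(ℝ, EG)) (I' := 𝓘(ℝ, E)) (n := ∞) (G := G) (M := Q)).comp
    (contMDiff_id.prodMk contMDiff_const)).contMDiffAt.mdifferentiableAt
      (by simp)).hasModelDerivAt

/-- The generator `ξ_{T^*Q}`, seen as an element of the model space and linear in `ξ`. -/
noncomputable def cotangentGeneratorCLM (α : CotangentBundle E Q) :
    EG →L[ℝ] E × (E →L[ℝ] ℝ) :=
  modelDeriv 𝓘(ℝ, EG) (cotangentModel E) (fun g : G => cotangentLift g α) 1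

variable (EG) in
theorem hasModelDerivAt_cotangentLift_orbit (α : CotangentBundle E Q) :
    HasModelDerivAt 𝓘(ℝ, EG) (cotangentModel E) (fun g : G => cotangentLift g α) 1
      (cotangentGeneratorCLM (G := G) α) :=
  (((contMDiff_cotangentLift (EG := EG) (G := G)).comp
    (contMDiff_id.prodMk contMDiff_const)).contMDiffAt.mdifferentiableAt
      (by simp)).hasModelDerivAt

/-- The momentum function of `ξ` in canonical coordinates. -/
theorem momentumMap_eq (α₀ α : CotangentBundle E Q)
    (h : α.proj ∈ (extChartAt 𝓘(ℝ, E) α₀.proj).source) (ξ : EG) :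
    momentumMap (EG := EG) (G := G) α ξ = (extChartAt (cotangentModel E) α₀ α).2
      (fderiv ℝ (fun y => extChartAt 𝓘(ℝ, E) α₀.proj ((extChartAt 𝓘(ℝ, EG) (1 : G)).symm y •
        (extChartAt 𝓘(ℝ, E) α₀.proj).symm (extChartAt 𝓘(ℝ, E) α₀.proj α.proj)))
        (extChartAt 𝓘(ℝ, EG) (1 : G) 1) ξ) := by
  have h1 := (hasModelDerivAt_extChartAt h).comp_of_eq
    ((hasModelDerivAt_orbit EG (G := G) α.proj).comp_of_eq
      (hasModelDerivAt_extChartAt_symm_one EG G) (extChartAt_to_inv 1))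
    (by rw [extChartAt_to_inv, one_smul])
  rw [hasModelDerivAt_iff_hasFDerivAt] at h1
  rw [(extChartAt 𝓘(ℝ, E) α₀.proj).left_inv h, h1.fderiv, cotangent_extChartAt_apply _ _ h]
  have := congrArg (fun A : E →L[ℝ] E => cotangentSnd α (A
    (modelDeriv 𝓘(ℝ, EG) 𝓘(ℝ, E) (fun g : G => g • α.proj) 1 ξ)))
      (modelDeriv_extChartAt_symm_comp h)
  exact this.symm

/-- `J` is a momentum map: `d J^ξ = ω(ξ_{T^*Q}, ·)`. -/
theorem hasModelDerivAt_momentumMap (α₀ : CotangentBundle E Q) (ξ : EG) :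
    ∃ D : E × (E →L[ℝ] ℝ) →L[ℝ] ℝ,
      HasModelDerivAt (cotangentModel E) 𝓘(ℝ, ℝ)
        (fun α : CotangentBundle E Q => momentumMap (EG := EG) (G := G) α ξ) α₀ D ∧
      ∀ v, D v = canonicalSymplecticForm α₀ (cotangentGeneratorCLM (G := G) α₀ ξ) v := by
  set κ := extChartAt 𝓘(ℝ, EG) (1 : G) with hκ
  set χ := extChartAt 𝓘(ℝ, E) α₀.proj with hχ
  set ψ := extChartAt (cotangentModel E) α₀ with hψ
  set e := κ 1 with he
  set x₀ := χ α₀.proj with hx₀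
  have hκe : κ.symm e = 1 := extChartAt_to_inv (1 : G)
  have hχx : χ.symm x₀ = α₀.proj := extChartAt_to_inv α₀.proj
  have hψ₁ : (ψ α₀).1 = x₀ := by
    rw [hψ, cotangent_extChartAt_apply _ _ (mem_extChartAt_source α₀.proj)]
  have hκs : ContMDiffAt 𝓘(ℝ, EG) 𝓘(ℝ, EG) ∞ κ.symm e :=
    (contMDiffOn_extChartAt_symm (1 : G)).contMDiffAt (extChartAt_target_mem_nhds (1 : G))
  have hχs : ContMDiffAt 𝓘(ℝ, E) 𝓘(ℝ, E) ∞ χ.symm x₀ :=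
    (contMDiffOn_extChartAt_symm α₀.proj).contMDiffAt (extChartAt_target_mem_nhds α₀.proj)
  have hsm : ∀ k : EG → G, ContMDiffAt 𝓘(ℝ, EG) 𝓘(ℝ, EG) ∞ k e → k e = 1 →
      ContDiffAt ℝ ∞ (fun z : EG × E => χ (k z.1 • χ.symm z.2)) (e, x₀) := by
    intro k hk hk1
    rw [← contMDiffAt_iff_contDiffAt]
    refine ContMDiffAt.comp_of_eq (y := α₀.proj) (g := χ) contMDiffAt_extChartAt ?_
      (by rw [hχx, hk1, one_smul])
    refine ContMDiffAt.comp (g := fun p : G × Q => p.1 • p.2)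
      (f := fun w : EG × E => (k w.1, χ.symm w.2)) _
      (contMDiff_smul (I := 𝓘(ℝ, EG)) (I' := 𝓘(ℝ, E)) (n := ∞) (G := G)
      (M := Q)).contMDiffAt ?_
    exact (ContMDiffAt.comp (g := k) (f := Prod.fst) (e, x₀) hk
      contDiff_fst.contMDiff.contMDiffAt).prodMk (ContMDiffAt.comp (g := χ.symm) (f := Prod.snd)
        (e, x₀) hχs contDiff_snd.contMDiff.contMDiffAt)
  have hΦ := hsm κ.symm hκs hκe
  have hΨ := hsm (fun y => (κ.symm y)⁻¹)
    (ContMDiffAt.comp e (contMDiff_inv 𝓘(ℝ, EG) ∞).contMDiffAt hκs) (by simp [hκe])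
  obtain ⟨B, hB₁, hB₂⟩ := hΦ.exists_hasFDerivAt_mixed_partials
  have hx₀t : x₀ ∈ χ.target := mem_extChartAt_target α₀.proj
  -- the momentum function in coordinates
  have hJ : HasModelDerivAt (cotangentModel E) 𝓘(ℝ, ℝ)
      (fun α : CotangentBundle E Q => momentumMap (EG := EG) (G := G) α ξ) α₀
      (((ContinuousLinearMap.apply ℝ ℝ (fderiv ℝ (fun y => χ (κ.symm y • χ.symm x₀)) e ξ)).comp
        (.snd ℝ E (E →L[ℝ] ℝ))) + ((ψ α₀).2.comp (B ξ)).comp (.fst ℝ E (E →L[ℝ] ℝ))) := by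
    have h1 : HasFDerivAt (fun z : E × (E →L[ℝ] ℝ) =>
        z.2 (fderiv ℝ (fun y => χ (κ.symm y • χ.symm z.1)) e ξ))
        (((ContinuousLinearMap.apply ℝ ℝ
            (fderiv ℝ (fun y => χ (κ.symm y • χ.symm x₀)) e ξ)).comp
          (.snd ℝ E (E →L[ℝ] ℝ))) + ((ψ α₀).2.comp (B ξ)).comp (.fst ℝ E (E →L[ℝ] ℝ)))
        (ψ α₀) := by
      -- `B.flip` is the x-derivative of the generator map, hence `B ξ` is that of the generator of
      -- ξ.
      have hX : HasFDerivAt (fun z : E × (E →L[ℝ] ℝ) =>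
          fderiv ℝ (fun y => χ (κ.symm y • χ.symm z.1)) e ξ)
          ((B ξ).comp (.fst ℝ E (E →L[ℝ] ℝ))) (ψ α₀) := by
        rw [← hψ₁] at hB₂
        have := (hB₂.comp (ψ α₀) hasFDerivAt_fst).clm_apply
          (hasFDerivAt_const ξ (ψ α₀))
        refine this.congr_fderiv ?_
        ext v <;> simp
      refine ((hasFDerivAt_snd (p := ψ α₀)).clm_apply hX).congr_fderiv ?_
      rw [hψ₁]
      ext v <;> simp
    have h2 := (hasModelDerivAt_iff_hasFDerivAt.2 h1).comp α₀ (hasModelDerivAt_extChartAt_self α₀)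
    rw [ContinuousLinearMap.comp_id] at h2
    refine h2.congr ?_
    filter_upwards [extChartAt_source_mem_nhds (I := cotangentModel E) α₀] with α hα
    rw [cotangent_extChartAt_source] at hα
    have h3 : (ψ α).1 = χ α.proj := by rw [hψ, cotangent_extChartAt_apply _ _ hα]
    simp only [Function.comp, h3]
    exact momentumMap_eq α₀ α hα ξ
  refine ⟨_, hJ, fun v => ?_⟩
  have hgen : HasFDerivAt (fun y => ψ (cotangentLift (κ.symm y) α₀))
      (cotangentGeneratorCLM (G := G) α₀) e := by
    rw [← hasModelDerivAt_iff_hasFDerivAt]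
    have := (hasModelDerivAt_extChartAt_self (I := cotangentModel E) α₀).comp_of_eq
      ((hasModelDerivAt_cotangentLift_orbit EG (G := G) α₀).comp_of_eq
      (hasModelDerivAt_extChartAt_symm_one EG G) hκe) (by rw [← hκ, ← he, hκe, cotangentLift_one])
    exact this
  have hact : Continuous (fun p : G × Q => p.1 • p.2) :=
    (contMDiff_smul (I := 𝓘(ℝ, EG)) (I' := 𝓘(ℝ, E)) (n := ∞) (G := G) (M := Q)).continuous
  have hact₀ : ContinuousAt (fun z : EG × E => κ.symm z.1 • χ.symm z.2) (e, x₀) :=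
    ContinuousAt.comp (f := fun z : EG × E => (κ.symm z.1, χ.symm z.2)) hact.continuousAt
      (ContinuousAt.prodMap hκs.continuousAt hχs.continuousAt)
  have hnear : ∀ᶠ z in 𝓝 (e, x₀), κ.symm z.1 • χ.symm z.2 ∈ χ.source :=
    hact₀.eventually_mem (by
      simp only [hκe, hχx, one_smul]; exact extChartAt_source_mem_nhds α₀.proj)
  have hsec : ContinuousAt (fun y : EG => (y, x₀)) e := by fun_prop
  have hφ : ContDiffAt ℝ ∞ (fun y => χ (κ.symm y • χ.symm x₀)) e :=
    ContDiffAt.comp (g := fun z : EG × E => χ (κ.symm z.1 • χ.symm z.2))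
      (f := fun y => (y, x₀)) e hΦ (contDiffAt_id.prodMk contDiffAt_const)
  have hφe : χ (κ.symm e • χ.symm x₀) = x₀ := by rw [hκe, one_smul, χ.right_inv hx₀t]
  have hA : DifferentiableAt ℝ (fun y => fderiv ℝ (fun x => χ ((κ.symm y)⁻¹ • χ.symm x))
      (χ (κ.symm y • χ.symm x₀))) e := by
    refine (ContDiffAt.fderiv (m := 1) (n := ∞)
      (f := fun y x => χ ((κ.symm y)⁻¹ • χ.symm x)) ?_ (hφ.of_le ENat.LEInfty.out)
      (by rw [one_add_one_eq_two]; exact ENat.LEInfty.out)).differentiableAt one_ne_zero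
    rw [hφe]
    exact hΨ
  have hC : fderiv ℝ (fun x => χ (κ.symm e • χ.symm x)) x₀ = .id ℝ E := by
    refine ((hasFDerivAt_id x₀).congr_of_eventuallyEq ?_).fderiv
    filter_upwards [extChartAt_target_mem_nhds (I := 𝓘(ℝ, E)) α₀.proj] with x hx
    rw [hκe, one_smul, χ.right_inv hx, id]
  -- For g near 1, the derivative of g⁻¹ at gx₀ is a left inverse of the derivative of g at x₀.
  have hAB : ∀ᶠ y in 𝓝 e, (fderiv ℝ (fun x => χ ((κ.symm y)⁻¹ • χ.symm x))
      (χ (κ.symm y • χ.symm x₀))).comp (fderiv ℝ (fun x => χ (κ.symm y • χ.symm x)) x₀) =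
      .id ℝ E := by
    have hΦd := ((hΦ.of_le (m := 1) ENat.LEInfty.out).eventually (by simp))
    have hΨd := ((hΨ.of_le (m := 1) ENat.LEInfty.out).eventually (by simp))
    have hsec' : Tendsto (fun y : EG => (y, χ (κ.symm y • χ.symm x₀))) (𝓝 e) (𝓝 (e, x₀)) := by
      have := (continuousAt_id (x := e)).prodMk hφ.continuousAt
      simpa only [ContinuousAt, hφe, id] using this
    filter_upwards [hsec.eventually hΦd, hsec'.eventually hΨd,
      hsec.eventually (eventually_eventually_nhds.2 hnear)] with y h1 h2 h3
    have h1' := (h1.differentiableAt one_ne_zero).comp x₀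
      (hasFDerivAt_prodMk_right y x₀).differentiableAt
    have h2' := (h2.differentiableAt one_ne_zero).comp (χ (κ.symm y • χ.symm x₀))
      (hasFDerivAt_prodMk_right y _).differentiableAt
    refine ((HasFDerivAt.comp (f := fun x => χ (κ.symm y • χ.symm x))
      (g := fun x => χ ((κ.symm y)⁻¹ • χ.symm x)) x₀ h2'.hasFDerivAt
      h1'.hasFDerivAt).unique ((hasFDerivAt_id x₀).congr_of_eventuallyEq ?_))
    have hsec'' : ContinuousAt (fun x : E => (y, x)) x₀ := by fun_prop
    filter_upwards [hsec''.eventually h3, extChartAt_target_mem_nhds (I := 𝓘(ℝ, E)) α₀.proj]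
      with x hx hxt
    simp only [Function.comp, id]
    rw [χ.left_inv hx, inv_smul_smul, χ.right_inv hxt]
  -- Differentiating `hAB` at `e`, where both factors are the identity, gives A' + B = 0.
  have hA' : HasFDerivAt (fun y => fderiv ℝ (fun x => χ ((κ.symm y)⁻¹ • χ.symm x))
      (χ (κ.symm y • χ.symm x₀))) (-B) e := by
    have hA₁ := hA.hasFDerivAt
    have h := ((hA₁.clm_comp hB₁).unique ((hasFDerivAt_const (ContinuousLinearMap.id ℝ E)
      e).congr_of_eventuallyEq hAB))
    have hAe := hAB.self_of_nhds
    simp only [hC, ContinuousLinearMap.comp_id] at h hAe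
    rw [hAe] at h
    convert hA₁ using 1
    ext η u
    have := congrArg (fun T : EG →L[ℝ] E →L[ℝ] E => T η u) h
    simp only [add_apply, ContinuousLinearMap.comp_apply,
      ContinuousLinearMap.compL_apply, ContinuousLinearMap.flip_apply,
      ContinuousLinearMap.id_comp, ContinuousLinearMap.comp_id,
      zero_apply] at this
    simpa using neg_eq_of_add_eq_zero_right this
  have hgen' : HasFDerivAt (fun y => ψ (cotangentLift (κ.symm y) α₀))
      ((fderiv ℝ (fun y => χ (κ.symm y • χ.symm x₀)) e).prod
        ((ContinuousLinearMap.compL ℝ E E ℝ (ψ α₀).2).comp (-B))) e := by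
    refine ((hφ.differentiableAt (by simp)).hasFDerivAt.prodMk
      ((ContinuousLinearMap.compL ℝ E E ℝ (ψ α₀).2).hasFDerivAt.comp e
        hA')).congr_of_eventuallyEq ?_
    filter_upwards [hsec.eventually hnear] with y hy
    rw [hχx] at hy
    rw [hψ, extChartAt_cotangentLift EG α₀ α₀ α₀ _ (mem_extChartAt_source α₀.proj) hy]
    simp only [Function.comp, hχx]
    rfl
  -- With X the generator on Q, the lifted generator is (X, -p ∘ Bξ); pairing it with v gives v.2(X)
  -- + p(Bξ(v.1)), which is D v.
  rw [canonicalSymplecticForm_apply, hgen.unique hgen']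
  simp [add_comm]
end Generator

/-! ### Maps with vanishing derivative are locally constant -/

section ZeroDerivative

variable {E : Type*} [NormedAddCommGroup E] [NormedSpace ℝ E]
  {M : Type*} [TopologicalSpace M] [ChartedSpace E M] [IsManifold 𝓘(ℝ, E) 1 M]
  {E' : Type*} [NormedAddCommGroup E'] [NormedSpace ℝ E']
  {H' : Type*} [TopologicalSpace H'] {I' : ModelWithCorners ℝ E' H'}
  {M' : Type*} [TopologicalSpace M'] [ChartedSpace H' M'] [IsManifold I' 1 M']

theorem eventually_eq_of_hasModelDerivAt_zero {f : M → M'} {x₀ : M}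
    (hf : ∀ᶠ x in 𝓝 x₀, HasModelDerivAt 𝓘(ℝ, E) I' f x 0) : ∀ᶠ x in 𝓝 x₀, f x = f x₀ := by
  set φ := extChartAt 𝓘(ℝ, E) x₀ with hφ
  set ψ := extChartAt I' (f x₀) with hψ
  have hsrc : ∀ᶠ x in 𝓝 x₀, HasModelDerivAt 𝓘(ℝ, E) I' f x 0 ∧ f x ∈ ψ.source :=
    hf.and (hf.self_of_nhds.continuousAt.eventually_mem (extChartAt_source_mem_nhds _))
  have hsymm : Tendsto φ.symm (𝓝 (φ x₀)) (𝓝 x₀) := by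
    have := continuousAt_extChartAt_symm (I := 𝓘(ℝ, E)) x₀
    rwa [ContinuousAt, extChartAt_to_inv] at this
  have hnear : ∀ᶠ y in 𝓝 (φ x₀), y ∈ φ.target ∧
      HasModelDerivAt 𝓘(ℝ, E) I' f (φ.symm y) 0 ∧ f (φ.symm y) ∈ ψ.source :=
    Filter.Eventually.and (extChartAt_target_mem_nhds (I := 𝓘(ℝ, E)) x₀) (hsymm.eventually hsrc)
  obtain ⟨r, hr, hball⟩ := Metric.eventually_nhds_iff_ball.1 hnear
  have hconst : ∀ y ∈ Metric.ball (φ x₀) r, ψ (f (φ.symm y)) = ψ (f x₀) := by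
    intro y hy
    have hd : ∀ z ∈ Metric.ball (φ x₀) r, HasFDerivAt (fun z => ψ (f (φ.symm z)))
        (0 : E →L[ℝ] E') z := by
      intro z hz
      obtain ⟨h1, h2, h3⟩ := hball z hz
      rw [← hasModelDerivAt_iff_hasFDerivAt]
      have := (hasModelDerivAt_extChartAt h3).comp_of_eq
        (h2.comp_of_eq (hasModelDerivAt_extChartAt_symm h1) rfl) rfl
      rwa [ContinuousLinearMap.zero_comp, ContinuousLinearMap.comp_zero] at this
    have h0 := Metric.mem_ball_self (x := φ x₀) hr
    have := Metric.isOpen_ball.is_const_of_fderiv_eq_zero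
      (convex_ball (φ x₀) r).isPreconnected
      (fun z hz => (hd z hz).differentiableAt.differentiableWithinAt)
      (fun z hz => (hd z hz).fderiv) hy h0
    simpa [hφ] using this
  have hmem : ∀ᶠ x in 𝓝 x₀, φ x ∈ Metric.ball (φ x₀) r :=
    (continuousAt_extChartAt (I := 𝓘(ℝ, E)) x₀).eventually_mem (Metric.ball_mem_nhds _ hr)
  filter_upwards [hmem, hsrc, extChartAt_source_mem_nhds (I := 𝓘(ℝ, E)) x₀] with x h1 h2 h3
  have := hconst _ h1
  rw [φ.left_inv h3] at this
  exact ψ.injOn h2.2 (mem_extChartAt_source _) this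

end ZeroDerivative

/-! ### Slice charts of embedded submanifolds -/

section Slice

universe u
variable {F : Type*} [NormedAddCommGroup F] [NormedSpace ℝ F]
  {E : Type u} [NormedAddCommGroup E] [NormedSpace ℝ E]
  {H : Type*} [TopologicalSpace H] {J : ModelWithCorners ℝ E H} [J.Boundaryless]
  {N : Type*} [TopologicalSpace N] [ChartedSpace H N]
  {L : Set N} [ChartedSpace F L]

/-- An embedded submanifold has slice charts. -/
theorem Manifold.IsSmoothEmbedding.exists_slice
    (hL : Manifold.IsSmoothEmbedding 𝓘(ℝ, F) J ∞ (Subtype.val : L → N)) (α : L) :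
    ∃ (V : Type u) (_ : NormedAddCommGroup V) (_ : NormedSpace ℝ V)
      (c : N → F × V) (d : F × V → N) (s : F → L),
      ContMDiffAt J 𝓘(ℝ, F × V) ∞ c (α : N) ∧ ContMDiffAt 𝓘(ℝ, F × V) J ∞ d (c α) ∧
      ContMDiffAt 𝓘(ℝ, F) 𝓘(ℝ, F) ∞ s (c α).1 ∧
      (∀ᶠ z in 𝓝 (α : N), d (c z) = z) ∧ (∀ᶠ w in 𝓝 (c α), c (d w) = w) ∧
      (∀ᶠ z in 𝓝 (α : N), z ∈ L → (c z).2 = 0) ∧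
      (∀ᶠ z in 𝓝 (α : N), (c z).2 = 0 → (s (c z).1 : N) = z) := by
  have h := hL.isImmersion.isImmersionAt α
  set A := h.codChart.extend J with hA
  set B := h.domChart.extend 𝓘(ℝ, F) with hB
  have hAα : (α : N) ∈ h.codChart.source := h.mem_codChart_source
  have hBα : α ∈ h.domChart.source := h.mem_domChart_source
  have hAsrc : A.source = h.codChart.source := h.codChart.extend_source
  have hBsrc : B.source = h.domChart.source := h.domChart.extend_source
  have hAnhds : ∀ᶠ z in 𝓝 (α : N), z ∈ A.source := by
    rw [hAsrc]; exact h.codChart.open_source.mem_nhds hAα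
  have hw : ∀ u ∈ B.target, A (B.symm u : L) = h.equiv (u, 0) := fun u hu =>
    h.writtenInCharts hu
  have hAc : ContMDiffAt J 𝓘(ℝ, E) ∞ A (α : N) :=
    h.codChart.contMDiffAt_extend h.codChart_mem_maximalAtlas hAα
  have hwα : A (α : N) = h.equiv (B α, 0) := by
    have := hw (B α) (B.map_source (by rwa [hBsrc]))
    rwa [B.left_inv (by rwa [hBsrc])] at this
  have hAtn : A.target ∈ 𝓝 (A (α : N)) :=
    h.codChart.isOpen_extend_target.mem_nhds (A.map_source (by rwa [hAsrc]))
  have hBtn : B.target ∈ 𝓝 (B α) :=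
    h.domChart.isOpen_extend_target.mem_nhds (B.map_source (by rwa [hBsrc]))
  have hAd : ContMDiffAt 𝓘(ℝ, E) J ∞ A.symm (A (α : N)) :=
    (contMDiffOn_extend_symm h.codChart_mem_maximalAtlas).contMDiffAt
      (by rwa [← h.codChart.extend_target'])
  have hBd : ContMDiffAt 𝓘(ℝ, F) 𝓘(ℝ, F) ∞ B.symm (B α) :=
    (contMDiffOn_extend_symm h.domChart_mem_maximalAtlas).contMDiffAt
      (by rwa [← h.domChart.extend_target'])
  have hcα : h.equiv.symm (A (α : N)) = (B α, 0) := by rw [hwα, h.equiv.symm_apply_apply]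
  have hc : ContMDiffAt J 𝓘(ℝ, F × h.complement) ∞ (fun z => h.equiv.symm (A z)) (α : N) :=
    h.equiv.symm.contDiff.contMDiff.contMDiffAt.comp (α : N) hAc
  -- `c` is the ambient chart straightened by `h.equiv`, so that the inclusion becomes u ↦ (u, 0);
  -- `s` is the inverse of the chart of L.
  refine ⟨h.complement, inferInstance, inferInstance, fun z => h.equiv.symm (A z),
    fun w => A.symm (h.equiv w), B.symm, hc, ?_, ?_, ?_, ?_, ?_, ?_⟩
  · refine ContMDiffAt.comp_of_eq (g := A.symm) hAd h.equiv.contDiff.contMDiff.contMDiffAt ?_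
    exact h.equiv.apply_symm_apply _
  · simpa only [hcα] using hBd
  · filter_upwards [hAnhds] with z hz
    rw [h.equiv.apply_symm_apply, A.left_inv hz]
  · have : ∀ᶠ w in 𝓝 (h.equiv.symm (A (α : N))), h.equiv w ∈ A.target :=
      h.equiv.continuous.continuousAt.eventually_mem (by rwa [h.equiv.apply_symm_apply])
    filter_upwards [this] with w hw'
    rw [A.right_inv hw', h.equiv.symm_apply_apply]
  -- L carries the subspace topology, so the points of L that are close to α in N lie in the chart
  -- domain of L.
  · obtain ⟨U, hU, hUs⟩ := isOpen_induced_iff.1 h.domChart.open_source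
    have hαU : (α : N) ∈ U := by
      have : α ∈ Subtype.val ⁻¹' U := by rw [hUs]; exact hBα
      exact this
    filter_upwards [hU.mem_nhds hαU] with z hzU hzL
    have hzs : (⟨z, hzL⟩ : L) ∈ B.source := by
      rw [hBsrc, ← hUs]; exact hzU
    have := hw _ (B.map_source hzs)
    rw [B.left_inv hzs] at this
    rw [this, h.equiv.symm_apply_apply]
  · have : ∀ᶠ z in 𝓝 (α : N), (h.equiv.symm (A z)).1 ∈ B.target :=
      (continuous_fst.continuousAt.comp hc.continuousAt).eventually_mem (by
        simpa only [Function.comp, hcα] using hBtn)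
    filter_upwards [this, hAnhds] with z hzB hzA hz0
    have h1 := hw _ hzB
    have h2 : h.equiv ((h.equiv.symm (A z)).1, 0) = A z := by
      rw [← hz0, Prod.mk.eta, h.equiv.apply_symm_apply]
    rw [h2] at h1
    refine A.injOn ?_ hzA h1
    rw [hAsrc]
    refine h.source_subset_preimage_source ?_
    rw [← hBsrc]
    exact B.map_target hzB

/-- The derivative of a map with values in a submanifold is tangent to the submanifold. -/
theorem Manifold.IsSmoothEmbedding.exists_modelDeriv_eq
    (hL : Manifold.IsSmoothEmbedding 𝓘(ℝ, F) J ∞ (Subtype.val : L → N))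
    {E' : Type*} [NormedAddCommGroup E'] [NormedSpace ℝ E']
    {H' : Type*} [TopologicalSpace H'] {I' : ModelWithCorners ℝ E' H'}
    {M' : Type*} [TopologicalSpace M'] [ChartedSpace H' M']
    {f : M' → N} {x : M'} {f' : E' →L[ℝ] E} (hf : HasModelDerivAt I' J f x f')
    (hfL : ∀ᶠ y in 𝓝 x, f y ∈ L) (α : L) (hα : f x = α) (v : E') :
    ∃ u : F, modelDeriv 𝓘(ℝ, F) J (Subtype.val : L → N) α u = f' v := by
  obtain ⟨V, _, _, c, d, s, hc, hd, hs, -, -, hLc, hcL⟩ := hL.exists_slice α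
  have hfc : Tendsto f (𝓝 x) (𝓝 (α : N)) := hα ▸ hf.continuousAt
  have hsα : s (c α).1 = α := Subtype.ext (hcL.self_of_nhds (hLc.self_of_nhds α.2))
  have h1 := ((hL.contMDiff α).mdifferentiableAt (by simp)).hasModelDerivAt.comp_of_eq
    ((hs.mdifferentiableAt (by simp)).hasModelDerivAt.comp_of_eq (f := fun w : F × V => w.1)
      (x := c α) (hasModelDerivAt_iff_hasFDerivAt.2 hasFDerivAt_fst) rfl) hsα
  have h2 := h1.comp_of_eq ((hc.mdifferentiableAt (by simp)).hasModelDerivAt.comp_of_eq hf hα)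
    (by rw [hα])
  -- Near `x`, f equals the inclusion after s ∘ pr₁ ∘ c ∘ f, so the chain rule puts f' in the range
  -- of the derivative of the inclusion.
  have h3 := h2.unique (hf.congr (by
    filter_upwards [hfL, hfc.eventually hLc, hfc.eventually hcL] with y h4 h5 h6
    exact h6 (h5 h4)))
  rw [← h3]
  exact ⟨_, rfl⟩

end Slice

/-! ### A Grönwall estimate -/

section Gronwall

variable {X V : Type*} [NormedAddCommGroup X] [NormedSpace ℝ X]
  [NormedAddCommGroup V] [NormedSpace ℝ V]

/-- Grönwall's inequality is applied on each segment from `e` to `y`, with constant K‖y - e‖. -/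
theorem eventually_eq_zero_of_norm_fderiv_le {f : X → V} {e : X} {K : ℝ} (he : f e = 0)
    (hf : ∀ᶠ y in 𝓝 e, ∃ f' : X →L[ℝ] V, HasFDerivAt f f' y ∧ ‖f'‖ ≤ K * ‖f y‖) :
    ∀ᶠ y in 𝓝 e, f y = 0 := by
  obtain ⟨r, hr, hball⟩ := Metric.eventually_nhds_iff_ball.1 hf
  filter_upwards [Metric.ball_mem_nhds e hr] with y hy
  have hmem : ∀ t ∈ Icc (0 : ℝ) 1, e + t • (y - e) ∈ Metric.ball e r := fun t ht =>
    (convex_ball e r).add_smul_sub_mem (Metric.mem_ball_self hr) hy ht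
  choose! f' hf' hle using hball
  have hd : ∀ t ∈ Icc (0 : ℝ) 1, HasDerivAt (fun t : ℝ => f (e + t • (y - e)))
      (f' (e + t • (y - e)) (y - e)) t := by
    intro t ht
    have h1 : HasDerivAt (fun t : ℝ => e + t • (y - e)) (y - e) t := by
      simpa using ((hasDerivAt_id t).smul_const (y - e)).const_add e
    exact (hf' _ (hmem t ht)).comp_hasDerivAt t h1
  have := eq_zero_of_abs_deriv_le_mul_abs_self_of_eq_zero_right (K := K * ‖y - e‖)
    (fun t ht => (hd t ht).continuousAt.continuousWithinAt)
    (fun t ht => (hd t (Ico_subset_Icc_self ht)).hasDerivWithinAt) (by simpa using he)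
    (fun t ht => by
      refine (ContinuousLinearMap.le_opNorm _ _).trans ?_
      rw [mul_right_comm]
      exact mul_le_mul_of_nonneg_right (hle _ (hmem t (Ico_subset_Icc_self ht)))
        (norm_nonneg _)) 1 (right_mem_Icc.2 zero_le_one)
  simpa using this

end Gronwall

/-! ### Tangent generators keep points in the submanifold for small group elements -/

section TangentAction

universe u
variable {F : Type*} [NormedAddCommGroup F] [NormedSpace ℝ F]
  {E : Type u} [NormedAddCommGroup E] [NormedSpace ℝ E]
  {H : Type*} [TopologicalSpace H] {J : ModelWithCorners ℝ E H} [J.Boundaryless]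
  {N : Type*} [TopologicalSpace N] [ChartedSpace H N] [IsManifold J ∞ N]
  {L : Set N} [ChartedSpace F L]
  {EG : Type*} [NormedAddCommGroup EG] [NormedSpace ℝ EG]
  {G : Type*} [TopologicalSpace G] [ChartedSpace EG G] [Group G] [LieGroup 𝓘(ℝ, EG) ∞ G]

/-- If the generators of a smooth action are tangent to a submanifold, then group elements close
to `1` move a given point of the submanifold inside the submanifold. -/
theorem eventually_act_mem_of_tangent {act : G → N → N}
    (hact : ContMDiff (𝓘(ℝ, EG).prod J) J ∞ (fun z : G × N => act z.1 z.2))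
    (hone : ∀ z, act 1 z = z) (hmul : ∀ g h z, act (g * h) z = act g (act h z))
    (hL : Manifold.IsSmoothEmbedding 𝓘(ℝ, F) J ∞ (Subtype.val : L → N))
    (htan : ∀ (β : L) (ξ : EG), ∃ u : F, modelDeriv 𝓘(ℝ, F) J (Subtype.val : L → N) β u =
      modelDeriv 𝓘(ℝ, EG) J (fun g => act g β) 1 ξ) (α : L) :
    ∀ᶠ g in 𝓝 (1 : G), act g α ∈ L := by
  obtain ⟨V, _, _, c, d, s, hc, hd, -, hdc, hcd, hLc, hcL⟩ := hL.exists_slice α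
  set κ := extChartAt 𝓘(ℝ, EG) (1 : G) with hκ
  set e := κ 1 with he
  set w₀ := c α with hw₀
  have hdw₀ : d w₀ = α := hdc.self_of_nhds
  have hw₀2 : w₀.2 = 0 := hLc.self_of_nhds α.2
  have hκe : κ.symm e = 1 := extChartAt_to_inv (1 : G)
  have hκs : ContMDiffAt 𝓘(ℝ, EG) 𝓘(ℝ, EG) ∞ κ.symm e :=
    (contMDiffOn_extChartAt_symm (1 : G)).contMDiffAt (extChartAt_target_mem_nhds (1 : G))
  have hκc : Tendsto κ.symm (𝓝 e) (𝓝 1) := hκe ▸ hκs.continuousAt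
  have hΨ : ContDiffAt ℝ ∞
      (fun z : EG × (F × V) => (c (act (κ.symm z.1) (d z.2))).2) (e, w₀) := by
    rw [← contMDiffAt_iff_contDiffAt]
    have h1 : ContMDiffAt 𝓘(ℝ, EG × (F × V)) J ∞
        (fun z : EG × (F × V) => act (κ.symm z.1) (d z.2)) (e, w₀) :=
      ContMDiffAt.comp (g := fun p : G × N => act p.1 p.2)
        (f := fun z : EG × (F × V) => (κ.symm z.1, d z.2)) _ hact.contMDiffAt
        ((ContMDiffAt.comp (g := κ.symm) (f := Prod.fst) (e, w₀) hκs
          contDiff_fst.contMDiff.contMDiffAt).prodMk (ContMDiffAt.comp (g := d) (f := Prod.snd)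
          (e, w₀) hd contDiff_snd.contMDiff.contMDiffAt))
    exact ContMDiffAt.comp (g := Prod.snd) (e, w₀) contDiff_snd.contMDiff.contMDiffAt
      (hc.comp_of_eq h1 (by rw [hκe, hone, hdw₀]))
  have hm : ContDiffAt ℝ ∞ (fun z : EG × EG => κ (κ.symm z.2 * (κ.symm z.1)⁻¹)) (e, e) := by
    rw [← contMDiffAt_iff_contDiffAt]
    refine ContMDiffAt.comp_of_eq (y := (1 : G)) (g := κ) contMDiffAt_extChartAt ?_
      (by simp [hκe])
    exact ContMDiffAt.mul (ContMDiffAt.comp (g := κ.symm) (f := Prod.snd) (e, e) hκs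
      contDiff_snd.contMDiff.contMDiffAt) (ContMDiffAt.inv (ContMDiffAt.comp (g := κ.symm)
      (f := Prod.fst) (e, e) hκs contDiff_fst.contMDiff.contMDiffAt))
  have hB : ContDiffAt ℝ 1
      (fun w => fderiv ℝ (fun y => (c (act (κ.symm y) (d w))).2) e) w₀ := by
    refine ContDiffAt.fderiv (n := ∞) (f := fun w y => (c (act (κ.symm y) (d w))).2) ?_
      contDiffAt_const (by rw [one_add_one_eq_two]; exact ENat.LEInfty.out)
    exact ContDiffAt.comp (g := fun z : EG × (F × V) => (c (act (κ.symm z.1) (d z.2))).2)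
      (f := Prod.swap) (w₀, e) hΨ (contDiff_snd.prodMk contDiff_fst).contDiffAt
  have hR : ContDiffAt ℝ 1
      (fun y => fderiv ℝ (fun z => κ (κ.symm z * (κ.symm y)⁻¹)) y) e :=
    ContDiffAt.fderiv (n := ∞) (f := fun y z => κ (κ.symm z * (κ.symm y)⁻¹)) (g := id) hm
      contDiffAt_id (by rw [one_add_one_eq_two]; exact ENat.LEInfty.out)
  -- A point with w.2 = 0 lies on L, the generator is tangent there, and the second component of `c`
  -- vanishes along L.
  have hB0 : ∀ᶠ w in 𝓝 w₀, w.2 = 0 →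
      fderiv ℝ (fun y => (c (act (κ.symm y) (d w))).2) e = 0 := by
    have hdt : Tendsto d (𝓝 w₀) (𝓝 (α : N)) := hdw₀ ▸ hd.continuousAt
    have hcd' := (contMDiffAt_iff_contMDiffAt_nhds (n := 1) (by simp)).1
      (hc.of_le ENat.LEInfty.out)
    filter_upwards [hcd, hdt.eventually hcL, hdt.eventually (eventually_eventually_nhds.2 hLc),
      hdt.eventually hcd'] with w h1 h2 h3 h4 hw
    have hβ := h2 (by rw [h1, hw])
    set β := s (c (d w)).1
    have hP := (hasModelDerivAt_iff_hasFDerivAt.2 (hasFDerivAt_snd (𝕜 := ℝ)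
      (p := c (d w)))).comp_of_eq (h4.mdifferentiableAt one_ne_zero).hasModelDerivAt rfl
    have hι : HasModelDerivAt 𝓘(ℝ, F) J (Subtype.val : L → N) β _ :=
      ((hL.contMDiff β).mdifferentiableAt (by simp)).hasModelDerivAt
    have h5 := (hP.comp_of_eq hι hβ).unique ((hasModelDerivAt_const (0 : V) β).congr (by
      have hιc : Tendsto (Subtype.val : L → N) (𝓝 β) (𝓝 (β : N)) := hι.continuousAt
      rw [hβ] at hιc
      filter_upwards [hιc.eventually h3] with b hb
      exact hb b.2))
    have horb : HasModelDerivAt 𝓘(ℝ, EG) J (fun g => act g β) 1 _ :=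
      ((hact.comp (contMDiff_id.prodMk contMDiff_const)).contMDiffAt.mdifferentiableAt
        (by simp)).hasModelDerivAt
    rw [← hβ]
    have h6 := hP.comp_of_eq (horb.comp_of_eq (hasModelDerivAt_extChartAt_symm_one EG G) hκe)
      (by rw [← hκ, ← he, hκe, hone, hβ])
    rw [(hasModelDerivAt_iff_hasFDerivAt.1 h6).fderiv]
    ext ξ
    obtain ⟨u, hu⟩ := htan β ξ
    have h7 := congrArg (fun T : F →L[ℝ] V => T u) h5
    simp only [ContinuousLinearMap.comp_apply, ContinuousLinearMap.id_apply, hu] at h7 ⊢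
    exact h7
  obtain ⟨K, t, ht, hK⟩ := hB.exists_lipschitzOnWith
  -- Compare w with (w.1, 0), where the derivative vanishes, using the Lipschitz bound.
  have hBle : ∀ᶠ w in 𝓝 w₀,
      ‖fderiv ℝ (fun y => (c (act (κ.symm y) (d w))).2) e‖ ≤ K * ‖w.2‖ := by
    have hproj : Tendsto (fun w : F × V => (w.1, (0 : V))) (𝓝 w₀) (𝓝 w₀) := by
      have : Continuous (fun w : F × V => (w.1, (0 : V))) := by fun_prop
      have h := this.tendsto w₀
      have hw : (w₀.1, (0 : V)) = w₀ := Prod.ext rfl hw₀2.symm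
      rwa [hw] at h
    filter_upwards [ht, hproj.eventually ht, hproj.eventually hB0] with w h1 h2 h3
    have := hK.norm_sub_le h1 h2
    rw [h3 rfl, sub_zero] at this
    simpa [Prod.norm_def] using this
  obtain ⟨C, hC⟩ : ∃ C : ℝ, ∀ᶠ y in 𝓝 e,
      ‖fderiv ℝ (fun z => κ (κ.symm z * (κ.symm y)⁻¹)) y‖ ≤ C := by
    refine ⟨_, (hR.continuousAt.norm.eventually (gt_mem_nhds (lt_add_one _))).mono
      fun y hy => le_of_lt hy⟩
  have hg : Tendsto (fun y => act (κ.symm y) α) (𝓝 e) (𝓝 (α : N)) := by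
    have : ContinuousAt (fun g => act g α) 1 :=
      (hact.comp (contMDiff_id.prodMk contMDiff_const)).continuous.continuousAt
    rw [ContinuousAt, hone] at this
    exact this.comp hκc
  have hf : Tendsto (fun y => c (act (κ.symm y) α)) (𝓝 e) (𝓝 w₀) :=
    hc.continuousAt.tendsto.comp hg
  -- Writing hα = (hg⁻¹)(gα), the derivative at g is the generator map at gα composed with a right
  -- translation. These factors are bounded by K times the transverse coordinate of gα and by C.
  have hf2 : ∀ᶠ y in 𝓝 e, (c (act (κ.symm y) α)).2 = 0 := by
    refine eventually_eq_zero_of_norm_fderiv_le (K := K * C) ?_ ?_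
    · rw [hκe, hone, ← hw₀, hw₀2]
    have hsec : Tendsto (fun y => (e, c (act (κ.symm y) α))) (𝓝 e) (𝓝 (e, w₀)) :=
      tendsto_const_nhds.prodMk_nhds hf
    have hdiag : Tendsto (fun y => (y, y)) (𝓝 e) (𝓝 (e, e)) :=
      tendsto_id.prodMk_nhds tendsto_id
    have hΨd := ((hΨ.of_le (m := 1) ENat.LEInfty.out).eventually (by simp))
    have hmd := ((hm.of_le (m := 1) ENat.LEInfty.out).eventually (by simp))
    filter_upwards [hf.eventually hBle, hC, hsec.eventually hΨd, hdiag.eventually hmd,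
      hg.eventually hdc, extChartAt_target_mem_nhds (I := 𝓘(ℝ, EG)) (1 : G)]
      with y h1 h2 h3 h4 h5 h6
    have hR' := ((h4.differentiableAt one_ne_zero).comp y
      (hasFDerivAt_prodMk_right y y).differentiableAt).hasFDerivAt
    have hB' := (DifferentiableAt.comp (f := fun z => (z, c (act (κ.symm y) α)))
      (g := fun z : EG × (F × V) => (c (act (κ.symm z.1) (d z.2))).2) e
      (h3.differentiableAt one_ne_zero)
      (hasFDerivAt_prodMk_left e (c (act (κ.symm y) α))).differentiableAt).hasFDerivAt
    have hye : κ (κ.symm y * (κ.symm y)⁻¹) = e := by rw [mul_inv_cancel]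
    have hcomp := HasFDerivAt.comp
      (f := fun z => κ (κ.symm z * (κ.symm y)⁻¹))
      (g := fun z => (c (act (κ.symm z) (d (c (act (κ.symm y) α))))).2) y
      (by rw [hye]; exact hB') hR'
    refine ⟨_, hcomp.congr_of_eventuallyEq ?_, (ContinuousLinearMap.opNorm_comp_le _ _).trans ?_⟩
    · have hcont : ContinuousAt (fun z => κ.symm z * (κ.symm y)⁻¹) y := by
        have : ContinuousAt κ.symm y := continuousAt_extChartAt_symm'' h6
        have hmulc : Continuous (fun g : G => g * (κ.symm y)⁻¹) :=
          (contMDiff_mul_right (I := 𝓘(ℝ, EG)) (n := ∞)).continuous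
        exact ContinuousAt.comp (g := fun g : G => g * (κ.symm y)⁻¹) hmulc.continuousAt this
      filter_upwards [hcont.eventually_mem (by
        rw [mul_inv_cancel]; exact extChartAt_source_mem_nhds (I := 𝓘(ℝ, EG)) (1 : G))] with z hz
      simp only [Function.comp]
      rw [h5, κ.left_inv hz, ← hmul, inv_mul_cancel_right]
    · have hC0 : 0 ≤ C := (norm_nonneg _).trans h2
      calc _ ≤ (K * ‖(c (act (κ.symm y) α)).2‖) * C :=
            mul_le_mul h1 h2 (norm_nonneg _) (by positivity)
        _ = _ := by ring
  have hfin : ∀ᶠ y in 𝓝 e, act (κ.symm y) α ∈ L := by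
    filter_upwards [hf2, hg.eventually hcL] with y h1 h2
    rw [← h2 h1]
    exact Subtype.property _
  filter_upwards [(continuousAt_extChartAt (I := 𝓘(ℝ, EG)) (1 : G)).eventually hfin,
    extChartAt_source_mem_nhds (I := 𝓘(ℝ, EG)) (1 : G)] with g h1 h2
  rwa [κ.left_inv h2] at h1

end TangentAction

/-! ### Curves and neighbourhoods of 1 in a Lie group -/

section LieGroupCurves

variable {EG : Type*} [NormedAddCommGroup EG] [NormedSpace ℝ EG]
  {G : Type*} [TopologicalSpace G] [ChartedSpace EG G] [Group G] [LieGroup 𝓘(ℝ, EG) ∞ G]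

variable (EG G) in
/-- The multiplication of a Lie group in the chart at `1`. -/
theorem contDiffAt_mul_extChartAt_one :
    ContDiffAt ℝ ∞ (fun z : EG × EG => extChartAt 𝓘(ℝ, EG) (1 : G)
      ((extChartAt 𝓘(ℝ, EG) (1 : G)).symm z.1 * (extChartAt 𝓘(ℝ, EG) (1 : G)).symm z.2))
      (extChartAt 𝓘(ℝ, EG) (1 : G) 1, extChartAt 𝓘(ℝ, EG) (1 : G) 1) := by
  set κ := extChartAt 𝓘(ℝ, EG) (1 : G) with hκ
  set e := κ 1 with he
  have hκe : κ.symm e = 1 := extChartAt_to_inv (1 : G)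
  have hκs : ContMDiffAt 𝓘(ℝ, EG) 𝓘(ℝ, EG) ∞ κ.symm e :=
    (contMDiffOn_extChartAt_symm (1 : G)).contMDiffAt (extChartAt_target_mem_nhds (1 : G))
  rw [← contMDiffAt_iff_contDiffAt]
  refine ContMDiffAt.comp_of_eq (y := (1 : G)) (g := κ) contMDiffAt_extChartAt ?_
    (by simp [hκe])
  exact ContMDiffAt.mul (ContMDiffAt.comp (g := κ.symm) (f := Prod.fst) (e, e) hκs
    contDiff_fst.contMDiff.contMDiffAt) (ContMDiffAt.comp (g := κ.symm)
    (f := Prod.snd) (e, e) hκs contDiff_snd.contMDiff.contMDiffAt)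

variable (EG G) in
-- The unit laws make the restriction to each axis the identity near `e`, which determines the
-- derivative.
theorem hasStrictFDerivAt_mul_extChartAt_one :
    HasStrictFDerivAt (fun z : EG × EG => extChartAt 𝓘(ℝ, EG) (1 : G)
      ((extChartAt 𝓘(ℝ, EG) (1 : G)).symm z.1 * (extChartAt 𝓘(ℝ, EG) (1 : G)).symm z.2))
      (.fst ℝ EG EG + .snd ℝ EG EG)
      (extChartAt 𝓘(ℝ, EG) (1 : G) 1, extChartAt 𝓘(ℝ, EG) (1 : G) 1) := by
  have h := (contDiffAt_mul_extChartAt_one EG G).hasStrictFDerivAt (by simp)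
  set κ := extChartAt 𝓘(ℝ, EG) (1 : G) with hκ
  set e := κ 1 with he
  have hκe : κ.symm e = 1 := extChartAt_to_inv (1 : G)
  have ht : κ.target ∈ 𝓝 e := extChartAt_target_mem_nhds (1 : G)
  set D := fderiv ℝ (fun z : EG × EG => κ (κ.symm z.1 * κ.symm z.2)) (e, e)
  have h1 : D.comp (.inl ℝ EG EG) = .id ℝ EG := by
    refine (HasFDerivAt.comp (f := fun y : EG => (y, e)) e h.hasFDerivAt
      (hasFDerivAt_prodMk_left e e)).unique
      ((hasFDerivAt_id e).congr_of_eventuallyEq ?_)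
    filter_upwards [ht] with y hy
    simp only [Function.comp, hκe, mul_one, κ.right_inv hy, id]
  have h2 : D.comp (.inr ℝ EG EG) = .id ℝ EG := by
    refine (HasFDerivAt.comp (f := fun y : EG => (e, y)) e h.hasFDerivAt
      (hasFDerivAt_prodMk_right e e)).unique
      ((hasFDerivAt_id e).congr_of_eventuallyEq ?_)
    filter_upwards [ht] with y hy
    simp only [Function.comp, hκe, one_mul, κ.right_inv hy, id]
  have hD : D = .fst ℝ EG EG + .snd ℝ EG EG := by
    ext v
    · simpa using congrArg (fun T : EG →L[ℝ] EG => T v) h1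
    · simpa using congrArg (fun T : EG →L[ℝ] EG => T v) h2
  exact hD ▸ h

/-- A submonoid that contains a curve through `1` in every direction is a neighbourhood of `1`. -/
theorem Submonoid.mem_nhds_one_of_curves [FiniteDimensional ℝ EG] (P : Submonoid G)
    (hP : ∀ ξ : EG, ∃ x : ℝ → EG, x 0 = extChartAt 𝓘(ℝ, EG) (1 : G) 1 ∧ HasStrictDerivAt x ξ 0 ∧
      ∀ᶠ t in 𝓝 (0 : ℝ), (extChartAt 𝓘(ℝ, EG) (1 : G)).symm (x t) ∈ P) :
    (P : Set G) ∈ 𝓝 (1 : G) := by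
  have hm := hasStrictFDerivAt_mul_extChartAt_one EG G
  set κ := extChartAt 𝓘(ℝ, EG) (1 : G) with hκ
  set e := κ 1 with he
  have hκe : κ.symm e = 1 := extChartAt_to_inv (1 : G)
  have hκs : ContMDiffAt 𝓘(ℝ, EG) 𝓘(ℝ, EG) ∞ κ.symm e :=
    (contMDiffOn_extChartAt_symm (1 : G)).contMDiffAt (extChartAt_target_mem_nhds (1 : G))
  have hprod : ∀ᶠ z : EG × EG in 𝓝 (e, e), κ.symm z.1 * κ.symm z.2 ∈ κ.source := by
    have hmulc : Continuous (fun p : G × G => p.1 * p.2) :=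
      (contMDiff_mul 𝓘(ℝ, EG) ∞).continuous
    have : ContinuousAt (fun z : EG × EG => κ.symm z.1 * κ.symm z.2) (e, e) :=
      ContinuousAt.comp (g := fun p : G × G => p.1 * p.2)
        (f := fun z : EG × EG => (κ.symm z.1, κ.symm z.2)) hmulc.continuousAt
        (ContinuousAt.prodMap hκs.continuousAt hκs.continuousAt)
    refine this.eventually_mem ?_
    simp only [hκe, mul_one]
    exact extChartAt_source_mem_nhds (1 : G)
  -- Curves are multiplied together: since multiplication has derivative addition, the ranges of the
  -- derivatives add up. For W = ⊤ the derivative is onto, and a strictly differentiable map with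
  -- surjective derivative is open at the point.
  have key : ∀ W : Submodule ℝ EG, W.FG → ∃ (X : Type) (_ : NormedAddCommGroup X)
      (_ : NormedSpace ℝ X) (_ : CompleteSpace X) (f : X → EG) (f' : X →L[ℝ] EG), f 0 = e ∧
      HasStrictFDerivAt f f' 0 ∧ W ≤ f'.range ∧ ∀ᶠ v in 𝓝 0, κ.symm (f v) ∈ P := by
    refine Submodule.fg_induction ?_ ?_
    · intro ξ
      obtain ⟨x, hx0, hx, hxP⟩ := hP ξ
      refine ⟨ℝ, inferInstance, inferInstance, inferInstance, x, _, hx0, hx.hasStrictFDerivAt,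
        ?_, hxP⟩
      rw [Submodule.span_singleton_le_iff_mem]
      exact ⟨1, by simp⟩
    · rintro W₁ W₂ - - ⟨X₁, _, _, _, f₁, f₁', h₁, hd₁, hr₁, hP₁⟩
        ⟨X₂, _, _, _, f₂, f₂', h₂, hd₂, hr₂, hP₂⟩
      have hpair : HasStrictFDerivAt (fun v : X₁ × X₂ => (f₁ v.1, f₂ v.2))
          ((f₁'.comp (.fst ℝ X₁ X₂)).prod (f₂'.comp (.snd ℝ X₁ X₂))) 0 :=
        (HasStrictFDerivAt.comp (g := f₁) (0 : X₁ × X₂) hd₁ hasStrictFDerivAt_fst).prodMk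
          (HasStrictFDerivAt.comp (g := f₂) (0 : X₁ × X₂) hd₂ hasStrictFDerivAt_snd)
      have hpair0 : (f₁ (0 : X₁ × X₂).1, f₂ (0 : X₁ × X₂).2) = (e, e) := by
        simp [h₁, h₂]
      refine ⟨X₁ × X₂, inferInstance, inferInstance, inferInstance,
        fun v => κ (κ.symm (f₁ v.1) * κ.symm (f₂ v.2)), _, ?_,
        HasStrictFDerivAt.comp (g := fun z : EG × EG => κ (κ.symm z.1 * κ.symm z.2))
          (0 : X₁ × X₂) (by rw [hpair0]; exact hm) hpair, ?_, ?_⟩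
      · simp only [Prod.fst_zero, Prod.snd_zero, h₁, h₂, hκe, one_mul]
        exact he.symm
      · refine sup_le (hr₁.trans ?_) (hr₂.trans ?_)
        · rintro _ ⟨v, rfl⟩
          exact ⟨(v, 0), by simp⟩
        · rintro _ ⟨v, rfl⟩
          exact ⟨(0, v), by simp⟩
      · have hpc : Tendsto (fun v : X₁ × X₂ => (f₁ v.1, f₂ v.2)) (𝓝 0) (𝓝 (e, e)) := by
          have := hpair.continuousAt
          rwa [ContinuousAt, hpair0] at this
        filter_upwards [hpc.eventually hprod, (continuous_fst.tendsto (0 : X₁ × X₂)).eventually hP₁,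
          (continuous_snd.tendsto (0 : X₁ × X₂)).eventually hP₂] with v h3 h4 h5
        rw [κ.left_inv h3]
        exact P.mul_mem h4 h5
  obtain ⟨X, _, _, _, f, f', h0, hd, hr, hfP⟩ := key ⊤ (Module.finite_def.1 inferInstance)
  have : CompleteSpace EG := FiniteDimensional.complete ℝ EG
  have hmap := hd.map_nhds_eq_of_surj (top_le_iff.1 hr)
  rw [h0] at hmap
  have h1 : ∀ᶠ y in 𝓝 e, κ.symm y ∈ P := by
    rw [← hmap]; exact hfP
  filter_upwards [(continuousAt_extChartAt (I := 𝓘(ℝ, EG)) (1 : G)).eventually h1,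
    extChartAt_source_mem_nhds (I := 𝓘(ℝ, EG)) (1 : G)] with g h2 h3
  rwa [κ.left_inv h3] at h2

/-- Local one-parameter curves: solutions of the left-invariant equation of `ξ`. -/
theorem exists_leftInvariant_curve [CompleteSpace EG] (ξ : EG) :
    ∃ x : ℝ → EG, x 0 = extChartAt 𝓘(ℝ, EG) (1 : G) 1 ∧ HasStrictDerivAt x ξ 0 ∧
      ∃ ε > 0, ∀ t ∈ Ioo (-ε) ε, HasModelDerivAt 𝓘(ℝ, ℝ) 𝓘(ℝ, EG)
        (fun r => ((extChartAt 𝓘(ℝ, EG) (1 : G)).symm (x t))⁻¹ *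
          (extChartAt 𝓘(ℝ, EG) (1 : G)).symm (x r)) t (.toSpanSingleton ℝ ξ) := by
  have hm := contDiffAt_mul_extChartAt_one EG G
  have hm' := (hasStrictFDerivAt_mul_extChartAt_one EG G).hasFDerivAt
  set κ := extChartAt 𝓘(ℝ, EG) (1 : G) with hκ
  set e := κ 1 with he
  have hκe : κ.symm e = 1 := extChartAt_to_inv (1 : G)
  -- This is the left-invariant vector field of ξ in the chart at 1; being C¹, it has local integral
  -- curves.
  have hY : ContDiffAt ℝ 1 (fun y => fderiv ℝ (fun z => κ (κ.symm y * κ.symm z)) e ξ) e :=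
    (ContDiffAt.fderiv (n := ∞) (f := fun y z => κ (κ.symm y * κ.symm z)) hm contDiffAt_const
      (by rw [one_add_one_eq_two]; exact ENat.LEInfty.out)).clm_apply contDiffAt_const
  have hYe : fderiv ℝ (fun z => κ (κ.symm e * κ.symm z)) e ξ = ξ := by
    have h : HasFDerivAt (fun z => κ (κ.symm e * κ.symm z)) _ e :=
      HasFDerivAt.comp (f := fun y : EG => (e, y)) e hm' (hasFDerivAt_prodMk_right e e)
    rw [h.fderiv]
    simp
  obtain ⟨x, hx0, ε, hε, hx⟩ :=
    hY.exists_forall_mem_closedBall_exists_eq_forall_mem_Ioo_hasDerivAt₀ 0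
  simp only [zero_sub, zero_add] at hx
  have hxc : ContinuousAt x 0 := (hx 0 ⟨by linarith, hε⟩).continuousAt
  have hxt : ∀ᶠ t in 𝓝 (0 : ℝ), x t ∈ κ.target :=
    hxc.eventually_mem (by rw [hx0]; exact extChartAt_target_mem_nhds (1 : G))
  obtain ⟨δ, hδ, hδt⟩ := Metric.eventually_nhds_iff.1 hxt
  -- δ keeps x(t) inside the chart target.
  refine ⟨x, hx0, ?_, min ε δ, lt_min hε hδ, ?_⟩
  · have h1 := hasStrictDerivAt_of_hasDerivAt_of_continuousAt (f := x) (x := 0)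
      (by filter_upwards [Ioo_mem_nhds (neg_lt_zero.2 hε) hε] with t ht using hx t ht)
      (ContinuousAt.comp_of_eq (f := x) hY.continuousAt hxc hx0)
    simpa only [hx0, hYe, Function.comp] using h1
  · intro t ht
    have hxd := hx t ⟨(neg_le_neg (min_le_left ε δ)).trans_lt ht.1,
      ht.2.trans_le (min_le_left ε δ)⟩
    have hy : x t ∈ κ.target := hδt (by
      rw [Real.dist_0_eq_abs, abs_lt]
      exact ⟨(neg_le_neg (min_le_right ε δ)).trans_lt ht.1, ht.2.trans_le (min_le_right ε δ)⟩)
    set b := κ.symm (x t) with hb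
    have hbs : b ∈ κ.source := κ.map_target hy
    have hκb : κ b = x t := κ.right_inv hy
    have hleft : ∀ a g : G, HasModelDerivAt 𝓘(ℝ, EG) 𝓘(ℝ, EG) (fun r => a * r) g
        (modelDeriv 𝓘(ℝ, EG) 𝓘(ℝ, EG) (fun r => a * r) g) := fun a g =>
      ((contMDiff_mul_left (I := 𝓘(ℝ, EG)) (n := ∞) (a := a)).contMDiffAt.mdifferentiableAt
        (by simp)).hasModelDerivAt
    have h1 := (hasModelDerivAt_extChartAt hbs).comp_of_eq
      ((hleft b 1).comp_of_eq (hasModelDerivAt_extChartAt_symm_one EG G) hκe)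
      (by rw [← hκ, ← he, hκe, mul_one])
    have h2 := (hleft b⁻¹ b).comp_of_eq ((hasModelDerivAt_extChartAt_symm hy).comp_of_eq
      (hasModelDerivAt_iff_hasFDerivAt.2 hxd.hasFDerivAt) rfl) rfl
    have h3 := modelDeriv_extChartAt_symm_comp hbs
    have h4 : (modelDeriv 𝓘(ℝ, EG) 𝓘(ℝ, EG) (fun r => b⁻¹ * r) b).comp
        (modelDeriv 𝓘(ℝ, EG) 𝓘(ℝ, EG) (fun r => b * r) 1) = .id ℝ EG :=
      ((hleft b⁻¹ b).comp_of_eq (hleft b 1) (mul_one b)).unique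
        ((hasModelDerivAt_id 1).congr (Eventually.of_forall fun r => by simp))
    rw [(hasModelDerivAt_iff_hasFDerivAt.1 h1).fderiv] at h2
    rw [← hκ, hκb] at h3
    convert h2 using 1
    ext
    have h5 := congrArg (fun T : EG →L[ℝ] EG =>
      modelDeriv 𝓘(ℝ, EG) 𝓘(ℝ, EG) (fun r => b⁻¹ * r) b
        (T (modelDeriv 𝓘(ℝ, EG) 𝓘(ℝ, EG) (fun r => b * r) 1 ξ))) h3
    have h6 := congrArg (fun T : EG →L[ℝ] EG => T ξ) h4
    simp only [ContinuousLinearMap.comp_apply, ContinuousLinearMap.id_apply,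
      ContinuousLinearMap.toSpanSingleton_apply, one_smul] at h5 h6 ⊢
    rw [← hκ, h5, h6]

end LieGroupCurves

/-! ### From tangent or complete generators to invariance -/

section InvariantSets

universe u
variable {F : Type*} [NormedAddCommGroup F] [NormedSpace ℝ F]
  {E : Type u} [NormedAddCommGroup E] [NormedSpace ℝ E]
  {H : Type*} [TopologicalSpace H] {J : ModelWithCorners ℝ E H}
  {N : Type*} [TopologicalSpace N] [ChartedSpace H N] [IsManifold J ∞ N]
  {L : Set N}
  {EG : Type*} [NormedAddCommGroup EG] [NormedSpace ℝ EG]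
  {G : Type*} [TopologicalSpace G] [ChartedSpace EG G] [Group G] [LieGroup 𝓘(ℝ, EG) ∞ G]

/-- A closed submanifold to which the generators of a smooth action of a connected Lie group are
tangent is invariant. -/
theorem act_mem_of_isClosed [J.Boundaryless] [ChartedSpace F L] [ConnectedSpace G] {act : G → N → N}
    (hact : ContMDiff (𝓘(ℝ, EG).prod J) J ∞ (fun z : G × N => act z.1 z.2))
    (hone : ∀ z, act 1 z = z) (hmul : ∀ g h z, act (g * h) z = act g (act h z))
    (hL : Manifold.IsSmoothEmbedding 𝓘(ℝ, F) J ∞ (Subtype.val : L → N))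
    (htan : ∀ (β : L) (ξ : EG), ∃ u : F, modelDeriv 𝓘(ℝ, F) J (Subtype.val : L → N) β u =
      modelDeriv 𝓘(ℝ, EG) J (fun g => act g β) 1 ξ)
    (hcl : IsClosed L) {α : N} (hα : α ∈ L) (g : G) : act g α ∈ L := by
  have hcont : Continuous (fun g => act g α) :=
    (hact.comp (contMDiff_id.prodMk contMDiff_const)).continuous
  have hopen : IsOpen {g : G | act g α ∈ L} := by
    rw [isOpen_iff_mem_nhds]
    intro g₀ hg₀
    have h1 := eventually_act_mem_of_tangent hact hone hmul hL htan ⟨_, hg₀⟩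
    have h2 : Tendsto (fun g : G => g * g₀⁻¹) (𝓝 g₀) (𝓝 1) := by
      have : Continuous (fun g : G => g * g₀⁻¹) :=
        (contMDiff_mul_right (I := 𝓘(ℝ, EG)) (n := ∞)).continuous
      simpa using this.tendsto g₀
    filter_upwards [h2.eventually h1] with g hg
    rwa [← hmul, inv_mul_cancel_right] at hg
  have hclopen : IsClopen {g : G | act g α ∈ L} := ⟨hcl.preimage hcont, hopen⟩
  have := hclopen.eq_univ ⟨1, by simpa [hone] using hα⟩
  exact (this ▸ mem_univ g : g ∈ {g : G | act g α ∈ L})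

omit [LieGroup 𝓘(ℝ, EG) ∞ G] in
/-- An integral curve of the generator of `-ξ` is, for small times, given by the action of the
inverse of a left-invariant curve of `ξ`. -/
theorem act_curve_eq {act : G → N → N}
    (hact : ContMDiff (𝓘(ℝ, EG).prod J) J ∞ (fun z : G × N => act z.1 z.2))
    (hone : ∀ z, act 1 z = z) (hmul : ∀ g h z, act (g * h) z = act g (act h z))
    {b : ℝ → G} {ξ : EG} {ε : ℝ} (hb0 : b 0 = 1)
    (hb : ∀ t ∈ Ioo (-ε) ε, HasModelDerivAt 𝓘(ℝ, ℝ) 𝓘(ℝ, EG) (fun r => (b t)⁻¹ * b r) t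
      (.toSpanSingleton ℝ ξ))
    {γ : ℝ → N} (hγ : ∀ t, HasModelDerivAt 𝓘(ℝ, ℝ) J γ t (.toSpanSingleton ℝ
      (modelDeriv 𝓘(ℝ, EG) J (fun g => act g (γ t)) 1 (-ξ))))
    {t : ℝ} (ht : t ∈ Ioo (-ε) ε) : act (b t) (γ t) = γ 0 := by
  have hzero : ∀ r ∈ Ioo (-ε) ε,
      HasModelDerivAt 𝓘(ℝ, ℝ) J (fun t => act (b t) (γ t)) r 0 := by
    intro r hr
    have hA : HasModelDerivAt (𝓘(ℝ, EG).prod J) J (fun z : G × N => act z.1 z.2) (1, γ r) _ :=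
      (hact.contMDiffAt.mdifferentiableAt (by simp)).hasModelDerivAt
    set D := modelDeriv (𝓘(ℝ, EG).prod J) J (fun z : G × N => act z.1 z.2) (1, γ r)
    have h1 := (hA.comp_of_eq ((hasModelDerivAt_id (I := 𝓘(ℝ, EG)) (1 : G)).prodMk
      (hasModelDerivAt_const (I' := J) (γ r) (1 : G))) rfl).modelDeriv_eq
    have h2 := (hA.comp_of_eq ((hasModelDerivAt_const (I := J) (I' := 𝓘(ℝ, EG)) (1 : G)
      (γ r)).prodMk (hasModelDerivAt_id (γ r))) rfl).unique
      ((hasModelDerivAt_id (γ r)).congr (Eventually.of_forall fun z => hone z))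
    -- Translating by (b r)⁻¹ moves the computation to the identity, where the contributions of ξ
    -- and -ξ cancel (`hz`).
    have h3 := hA.comp_of_eq ((hb r hr).prodMk (hγ r)) (by simp)
    have hg : HasModelDerivAt J J (act (b r)) (γ r) _ :=
      ((hact.comp (contMDiff_const.prodMk contMDiff_id)).contMDiffAt.mdifferentiableAt
        (by simp)).hasModelDerivAt
    have h4 := (hg.comp_of_eq h3 (by simp [hone])).congr (g := fun t => act (b t) (γ t))
      (Eventually.of_forall fun t => by simp [← hmul])
    have hz : D.comp ((ContinuousLinearMap.toSpanSingleton ℝ ξ).prod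
        (.toSpanSingleton ℝ (modelDeriv 𝓘(ℝ, EG) J (fun g => act g (γ r)) 1 (-ξ)))) = 0 := by
      ext
      rw [h1]
      have h5 := congrArg (fun T : E →L[ℝ] E => T (D (-ξ, 0))) h2
      have h6 : D (ξ, D (-ξ, 0)) = D (ξ, 0) + D (0, D (-ξ, 0)) := by
        rw [← map_add]; simp
      have h7 : D (-ξ, 0) = - D (ξ, 0) := by
        rw [← map_neg]; simp
      simp only [ContinuousLinearMap.comp_apply, ContinuousLinearMap.prod_apply,
        ContinuousLinearMap.id_apply, zero_apply, ContinuousLinearMap.toSpanSingleton_apply,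
        one_smul] at h5 ⊢
      rw [h6, h5, h7, add_neg_cancel]
    rwa [hz, ContinuousLinearMap.comp_zero] at h4
  have hlc : IsLocallyConstant (fun r : Ioo (-ε) ε => act (b r) (γ r)) := by
    rw [IsLocallyConstant.iff_eventually_eq]
    intro r
    have := eventually_eq_of_hasModelDerivAt_zero (f := fun t => act (b t) (γ t)) (x₀ := (r : ℝ))
      (by filter_upwards [isOpen_Ioo.mem_nhds r.2] with t ht using hzero t ht)
    exact (continuous_subtype_val.tendsto r).eventually this
  have : PreconnectedSpace (Ioo (-ε) ε) := Subtype.preconnectedSpace isPreconnected_Ioo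
  have h0 : (0 : ℝ) ∈ Ioo (-ε) ε := by constructor <;> linarith [ht.1, ht.2]
  have := hlc.apply_eq_of_preconnectedSpace ⟨t, ht⟩ ⟨0, h0⟩
  simpa [hb0, hone] using this

/-- If all generators of a smooth action of a connected Lie group restrict to complete vector
fields on a subset, then the subset is invariant. -/
theorem act_mem_of_complete [FiniteDimensional ℝ EG] [ConnectedSpace G] {act : G → N → N}
    (hact : ContMDiff (𝓘(ℝ, EG).prod J) J ∞ (fun z : G × N => act z.1 z.2))
    (hone : ∀ z, act 1 z = z) (hmul : ∀ g h z, act (g * h) z = act g (act h z))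
    (hcomplete : ∀ (ξ : EG), ∀ α ∈ L, ∃ γ : ℝ → N, γ 0 = α ∧ (∀ t, γ t ∈ L) ∧
      ∀ t, HasModelDerivAt 𝓘(ℝ, ℝ) J γ t (.toSpanSingleton ℝ
        (modelDeriv 𝓘(ℝ, EG) J (fun g => act g (γ t)) 1 ξ)))
    {α : N} (hα : α ∈ L) (g : G) : act g α ∈ L := by
  have : IsTopologicalGroup G := topologicalGroup_of_lieGroup 𝓘(ℝ, EG) ∞
  have : CompleteSpace EG := FiniteDimensional.complete ℝ EG
  -- The inverse is needed because the curves supplied by completeness have the form b(t)⁻¹α.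
  let P : Submonoid G :=
    { carrier := {g | ∀ α ∈ L, act g⁻¹ α ∈ L}
      one_mem' := fun α hα => by simpa [hone] using hα
      mul_mem' := fun {g h} hg hh α hα => by
        rw [mul_inv_rev, hmul]
        exact hh _ (hg _ hα) }
  have hP : (P : Set G) ∈ 𝓝 (1 : G) := by
    refine P.mem_nhds_one_of_curves (EG := EG) fun ξ => ?_
    obtain ⟨x, hx0, hx, ε, hε, hxε⟩ := exists_leftInvariant_curve (G := G) ξ
    refine ⟨x, hx0, hx, ?_⟩
    filter_upwards [Ioo_mem_nhds (neg_lt_zero.2 hε) hε] with t ht α hα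
    obtain ⟨γ, rfl, hγL, hγ⟩ := hcomplete (-ξ) α hα
    rw [← act_curve_eq hact hone hmul
      (b := fun t => (extChartAt 𝓘(ℝ, EG) (1 : G)).symm (x t))
      (by rw [hx0, extChartAt_to_inv]) hxε hγ ht, ← hmul, inv_mul_cancel, hone]
    exact hγL t
  let S : Subgroup G :=
    { carrier := {g | g ∈ P ∧ g⁻¹ ∈ P}
      one_mem' := ⟨P.one_mem, by simp⟩
      mul_mem' := fun {g h} hg hh => ⟨P.mul_mem hg.1 hh.1, by
        rw [mul_inv_rev]; exact P.mul_mem hh.2 hg.2⟩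
      inv_mem' := fun {g} hg => ⟨hg.2, by simpa using hg.1⟩ }
  have hS : (S : Set G) ∈ 𝓝 (1 : G) := by
    have hinv : Tendsto (fun g : G => g⁻¹) (𝓝 1) (𝓝 1) := by
      simpa using (continuous_inv (G := G)).tendsto 1
    filter_upwards [hP, hinv.eventually hP] with g h1 h2 using ⟨h1, h2⟩
  have hSo : IsOpen (S : Set G) := S.isOpen_of_mem_nhds hS
  have hSc : IsClopen (S : Set G) := ⟨S.isClosed_of_isOpen hSo, hSo⟩
  have huniv := hSc.eq_univ ⟨1, S.one_mem⟩
  have hg : g ∈ (S : Set G) := huniv ▸ mem_univ g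
  simpa using hg.2 α hα

end InvariantSets

/-! ### Lagrangian submanifolds: tangency, constancy of J and invariance -/

section LagrangianSubmanifolds

variable {E : Type*} [NormedAddCommGroup E] [NormedSpace ℝ E]
  {Q : Type*} [TopologicalSpace Q] [ChartedSpace E Q] [IsManifold 𝓘(ℝ, E) ∞ Q]
  {EG : Type*} [NormedAddCommGroup EG] [NormedSpace ℝ EG]
  {G : Type*} [TopologicalSpace G] [ChartedSpace EG G] [Group G] [LieGroup 𝓘(ℝ, EG) ∞ G]
  [MulAction G Q] [ContMDiffSMul 𝓘(ℝ, EG) 𝓘(ℝ, E) ∞ G Q]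
  {F : Type*} [NormedAddCommGroup F] [NormedSpace ℝ F]
  {L : Set (CotangentBundle E Q)} [ChartedSpace F L]

theorem mem_submanifoldTangentSpace_iff (α : L) (v : E × (E →L[ℝ] ℝ)) :
    v ∈ (submanifoldTangentSpace F L α : Set (E × (E →L[ℝ] ℝ))) ↔
      ∃ u : F, modelDeriv 𝓘(ℝ, F) (cotangentModel E)
        (Subtype.val : L → CotangentBundle E Q) α u = v :=
  Iff.rfl

theorem IsLagrangianSubmanifold.hasModelDerivAt_val (hL : IsLagrangianSubmanifold F L) (α : L) :
    HasModelDerivAt 𝓘(ℝ, F) (cotangentModel E) (Subtype.val : L → CotangentBundle E Q) α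
      (modelDeriv 𝓘(ℝ, F) (cotangentModel E) (Subtype.val : L → CotangentBundle E Q) α) :=
  ((hL.isSmoothEmbedding.contMDiff α).mdifferentiableAt (by simp)).hasModelDerivAt

/-- The generator `ξ_{T^*Q}` is tangent to a Lagrangian submanifold at `α` if and only if the
derivative of `J^ξ` along the submanifold vanishes at `α`. -/
theorem IsLagrangianSubmanifold.generator_tangent_iff (hL : IsLagrangianSubmanifold F L) (α : L)
    (ξ : EG) :
    (∃ u : F, modelDeriv 𝓘(ℝ, F) (cotangentModel E)
        (Subtype.val : L → CotangentBundle E Q) α u = cotangentGeneratorCLM (G := G) α.1 ξ) ↔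
      HasModelDerivAt 𝓘(ℝ, F) 𝓘(ℝ, ℝ)
        (fun β : L => momentumMap (EG := EG) (G := G) β.1 ξ) α 0 := by
  obtain ⟨D, hD, hDω⟩ := hasModelDerivAt_momentumMap (G := G) α.1 ξ
  have hcomp := hD.comp_of_eq (hL.hasModelDerivAt_val α) rfl
  have horth := Set.ext_iff.1 (hL.tangentSpace_eq_orthogonal α)
    (cotangentGeneratorCLM (G := G) α.1 ξ)
  refine (mem_submanifoldTangentSpace_iff α _).symm.trans (horth.trans ?_)
  constructor
  · intro h
    convert hcomp using 1
    ext u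
    exact ((hDω _).trans (h _ ⟨u, rfl⟩)).symm
  · rintro h _ ⟨u, rfl⟩
    have := congrArg (fun T : F →L[ℝ] ℝ => T u) (hcomp.unique h)
    exact (hDω _).symm.trans this

theorem IsLagrangianSubmanifold.momentumConstantOn [IsManifold 𝓘(ℝ, F) ∞ L]
    (hL : IsLagrangianSubmanifold F L) (hconn : IsPreconnected L)
    (hinv : IsInvariantUnderLift G L) : MomentumConstantOn EG G L := by
  rcases L.eq_empty_or_nonempty with rfl | ⟨α₀, hα₀⟩
  -- Preconnectedness allows L to be empty, and then any value of J will do.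
  · exact ⟨0, fun α hα => hα.elim⟩
  refine ⟨momentumMap α₀, fun α hα => ContinuousLinearMap.ext fun ξ => ?_⟩
  have hmem : ∀ g : G, ∀ β ∈ L, cotangentLift g β ∈ L := fun g β hβ =>
    (hinv g).subset (mem_image_of_mem _ hβ)
  have hzero : ∀ β : L, HasModelDerivAt 𝓘(ℝ, F) 𝓘(ℝ, ℝ)
      (fun β : L => momentumMap (EG := EG) (G := G) β.1 ξ) β 0 := by
    intro β
    refine (hL.generator_tangent_iff (EG := EG) (G := G) β ξ).1 ?_
    exact hL.isSmoothEmbedding.exists_modelDeriv_eq (hasModelDerivAt_cotangentLift_orbit EG β.1)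
      (Eventually.of_forall fun g => hmem g β.1 β.2) β (cotangentLift_one β.1) ξ
  have : IsManifold 𝓘(ℝ, F) 1 L := IsManifold.of_le (n := ∞) ENat.LEInfty.out
  have hlc : IsLocallyConstant (fun β : L => momentumMap (EG := EG) (G := G) β.1 ξ) :=
    (IsLocallyConstant.iff_eventually_eq _).2 fun β =>
      eventually_eq_of_hasModelDerivAt_zero (Eventually.of_forall hzero)
  have : PreconnectedSpace L := Subtype.preconnectedSpace hconn
  exact hlc.apply_eq_of_preconnectedSpace ⟨α, hα⟩ ⟨α₀, hα₀⟩

theorem IsLagrangianSubmanifold.isInvariantUnderLift [FiniteDimensional ℝ EG] [ConnectedSpace G]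
    (hL : IsLagrangianSubmanifold F L) (hcases : IsClosed L ∨ HasCompleteGenerators EG G F L)
    (hJ : MomentumConstantOn EG G L) : IsInvariantUnderLift G L := by
  obtain ⟨μ, hμ⟩ := hJ
  have htan : ∀ (β : L) (ξ : EG), ∃ u : F, modelDeriv 𝓘(ℝ, F) (cotangentModel E)
      (Subtype.val : L → CotangentBundle E Q) β u = cotangentGeneratorCLM (G := G) β.1 ξ := by
    intro β ξ
    refine (hL.generator_tangent_iff (EG := EG) (G := G) β ξ).2 ?_
    exact (hasModelDerivAt_const (μ ξ) β).congr (Eventually.of_forall fun β' => by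
      simp only [hμ _ β'.2])
  have hmem : ∀ g : G, ∀ α ∈ L, cotangentLift g α ∈ L := by
    intro g α hα
    rcases hcases with hcl | hcomp
    · exact act_mem_of_isClosed (contMDiff_cotangentLift (EG := EG)) cotangentLift_one
        (cotangentLift_mul EG) hL.isSmoothEmbedding htan hcl hα g
    · exact act_mem_of_complete (contMDiff_cotangentLift (EG := EG)) cotangentLift_one
        (cotangentLift_mul EG) (fun ξ α hα => hcomp ξ (fun β => htan β ξ) α hα) hα g
  -- Only gL ⊆ L has been shown; applying it to g⁻¹ gives the other inclusion.
  refine fun g => (image_subset_iff.2 fun α hα => hmem g α hα).antisymm fun α hα =>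
    ⟨cotangentLift g⁻¹ α, hmem g⁻¹ α hα, ?_⟩
  rw [← cotangentLift_mul EG, mul_inv_cancel, cotangentLift_one]

end LagrangianSubmanifolds

end

theorem mainTheorem3
    {E : Type*} [NormedAddCommGroup E] [NormedSpace ℝ E] [FiniteDimensional ℝ E]
    {Q : Type*} [TopologicalSpace Q] [T2Space Q] [ChartedSpace E Q] [IsManifold 𝓘(ℝ, E) ∞ Q]
    {EG : Type*} [NormedAddCommGroup EG] [NormedSpace ℝ EG] [FiniteDimensional ℝ EG]
    {G : Type*} [TopologicalSpace G] [ChartedSpace EG G] [Group G] [LieGroup 𝓘(ℝ, EG) ∞ G]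
    [ConnectedSpace G]
    [MulAction G Q] [ContMDiffSMul 𝓘(ℝ, EG) 𝓘(ℝ, E) ∞ G Q]
    {F : Type*} [NormedAddCommGroup F] [NormedSpace ℝ F] [FiniteDimensional ℝ F]
    (L : Set (CotangentBundle E Q)) [ChartedSpace F L] [IsManifold 𝓘(ℝ, F) ∞ L]
    (hL : IsLagrangianSubmanifold F L) :
    (IsPreconnected L → IsInvariantUnderLift G L → MomentumConstantOn EG G L) ∧
    (IsClosed L ∨ HasCompleteGenerators EG G F L →
      MomentumConstantOn EG G L → IsInvariantUnderLift G L) ∧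
    (IsPreconnected L → IsClosed L ∨ HasCompleteGenerators EG G F L →
      (MomentumConstantOn EG G L ↔ IsInvariantUnderLift G L)) := by
  exact ⟨hL.momentumConstantOn, hL.isInvariantUnderLift, fun hconn hcases =>
    ⟨hL.isInvariantUnderLift hcases, hL.momentumConstantOn hconn⟩⟩
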